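/- All maps are finite maps on closed oriented surfaces. A polyhedral map is a simple 3-connected graph embedded in such a surface so that the closure of every face is a closed disk and the intersection of the closures of any two distinct faces is connected (possibly empty); it has genus $g$ if the surface has genus $g$. The barycentric subdivision $B_P$ of a map $P$ is the triangulation whose triangles (chambers) have one vertex of colour $0$ (a vertex of $P$), one of colour $1$ (an edge of $P$) and one of colour $2$ (a face of $P$). $\mathrm{Aut}(P)$ is the group of all automorphisms of $P$ (orientation-preserving or reversing), identified with the group of colour-preserving automorphisms of $B_P$. Let $T_H$ be the tiling of the plane by regular hexagons of side length $1$, with coordinates along two unit vectors at an angle of $60^\circ$, such that $(0,0)$ is the centre of a face and $(1,0)$ and $(0,1)$ are vertices of that face. Let $l\ge 1$ be an integer and let $m=l$ or $m=0$. The Goldberg--Coxeter operation $\mathrm{GC}(l,m)$ is the triangle with corners $v_0=(l,m)$, $v_1=\left(\frac{l-m}{2},\frac{l+2m}{2}\right)$, $v_2=(0,0)$ cut out of the barycentric subdivision of $T_H$. The colour of $v_0$ is its colour in that subdivision. Applying $O=\mathrm{GC}(l,m)$ to a map $P$ means gluing into every chamber of $B_P$ a copy of this triangle or of its mirror image, with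 $v_i$ placed at the vertex of colour $i$, so that copies in adjacent chambers are mirror images of each other in the common edge; the result is the barycentric subdivision of a map $O(P)$. The operation $O$ can increase symmetry in genus $g$ if there is a polyhedral map $P$ of genus $g$ with $|\mathrm{Aut}(P)|<|\mathrm{Aut}(O(P))|$. **Statement.** Let $l\ge 1$, let $m=l$ or $m=0$, and suppose that the vertex $v_0$ of $\mathrm{GC}(l,m)$ has colour $2$. If $m=0$, then $l=3k$ for some natural number $k$. Moreover, for every integer $g\ge 0$, the operation $\mathrm{GC}(l,m)$ can increase symmetry in genus $g$ if and only if $g\neq 0$. -/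

import Mathlib

/-! ### Maps on oriented closed surfaces, given by rotation systems -/

/-- A map on an oriented surface: a simple graph together with a circular (counterclockwise)
ordering `rot` of the darts (edge ends) at every vertex. -/
structure RotationMap (V : Type) where
  graph : SimpleGraph V
  rot : Equiv.Perm graph.Dart
  rot_fst : ∀ d, (rot d).fst = d.fst
  rot_cyclic : ∀ d d', d.fst = d'.fst → rot.SameCycle d d'

namespace RotationMap

variable {V : Type} (M : RotationMap V)

/-- The dart that follows `d` on the boundary walk of the face on the left of `d`. -/
def facePerm : Equiv.Perm M.graph.Dart :=
  (Function.Involutive.toPerm SimpleGraph.Dart.symm SimpleGraph.Dart.symm_involutive).trans M.rot.symm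

/-- A face is an orbit of `facePerm`: it is represented by the darts that have it on their left. -/
def Face : Type := Quotient (Equiv.Perm.SameCycle.setoid M.facePerm)

/-- The face on the left of a dart. -/
def leftFace (d : M.graph.Dart) : M.Face := Quotient.mk _ d

/-- The vertices and edges on the boundary of a face. -/
def boundary (f : M.Face) : M.graph.Subgraph where
  verts := {v | ∃ d, M.leftFace d = f ∧ d.fst = v}
  Adj u v := ∃ d, M.leftFace d = f ∧ d.edge = s(u, v)
  adj_sub := by
    rintro u v ⟨d, -, hd⟩
    have h := d.edge_mem
    rw [hd] at h
    exact h
  edge_vert := by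
    rintro u v ⟨d, hf, hd⟩
    rcases SimpleGraph.dart_edge_eq_mk'_iff'.1 hd with ⟨h, -⟩ | ⟨-, h⟩
    · exact ⟨d, hf, h⟩
    · refine ⟨M.facePerm d, ?_, ?_⟩
      · rw [← hf]
        exact Quotient.sound
          ((Equiv.Perm.sameCycle_apply_left (f := M.facePerm)).2 (Equiv.Perm.SameCycle.refl _ d))
      · have key := M.rot_fst (M.rot.symm d.symm)
        rw [Equiv.apply_symm_apply] at key
        change (M.rot.symm d.symm).fst = u
        rw [← key]
        exact h
  symm := ⟨by
    rintro u v ⟨d, hf, hd⟩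
    exact ⟨d, hf, hd.trans Sym2.eq_swap⟩⟩

/-- At least four vertices, and connected after the removal of any set of at most two vertices. -/
def IsThreeConnected {V : Type} (G : SimpleGraph V) : Prop :=
  4 ≤ Nat.card V ∧ ∀ S : Set V, S.ncard ≤ 2 → (G.induce Sᶜ).Connected

/-- A polyhedral map: the graph is 3-connected, the closure of every face is a closed disk (its
boundary walk does not repeat a vertex), and the intersection of the closures of two faces is
connected (possibly empty). -/
structure IsPolyhedral : Prop where
  threeConnected : IsThreeConnected M.graph
  disk : ∀ d d' : M.graph.Dart, M.leftFace d = M.leftFace d' → d.fst = d'.fst → d = d'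
  inter : ∀ f f' : M.Face, f ≠ f' → (M.boundary f ⊓ M.boundary f').Preconnected

/-- Euler's formula (for a connected map on an orientable surface). -/
def HasGenus (g : ℕ) : Prop :=
  (Nat.card V : ℤ) - Nat.card M.graph.edgeSet + Nat.card M.Face = 2 - 2 * g

/-- A chamber (flag) of the barycentric subdivision. The dart `d` fixes the vertex `d.fst` and the
edge `d.edge`; the face is the one on the left of `d` (`true`) or on its right (`false`). -/
abbrev Chamber : Type := M.graph.Dart × Bool

/-- The chamber that shares with the given one the edge of the barycentric subdivision opposite to
the vertex of colour `i`. -/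
def nbr : Fin 3 → M.Chamber → M.Chamber
  | 0, (d, b) => (d.symm, !b)
  | 1, (d, true) => (M.rot d, false)
  | 1, (d, false) => (M.rot.symm d, true)
  | 2, (d, b) => (d, !b)

/-- `i`-adjacency of the chambers of the barycentric subdivision. -/
def chamberAdj (i : Fin 3) (C D : M.Chamber) : Prop := M.nbr i C = D

end RotationMap

/-- The automorphism group of a 3-coloured triangulation that is given by its set of chambers and by
the relations `adj i`: two chambers share the edge opposite to their vertices of colour `i`. -/
def chamberAut {X : Type} (adj : Fin 3 → X → X → Prop) : Subgroup (Equiv.Perm X) where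
  carrier := {σ | ∀ i x y, adj i (σ x) (σ y) ↔ adj i x y}
  one_mem' := fun _ _ _ => Iff.rfl
  mul_mem' := fun {σ τ} hσ hτ i x y => (hσ i (τ x) (τ y)).trans (hτ i x y)
  inv_mem' := fun {σ} hσ i x y => by
    have h := hσ i (σ.symm x) (σ.symm y)
    rw [Equiv.apply_symm_apply, Equiv.apply_symm_apply] at h
    exact h.symm

/-! ### The regular hexagonal tiling

Points of the plane are written in coordinates along two unit vectors at an angle of 60 degrees,
hexagons have side length 1, and the origin is the centre of a hexagon. All coordinates are
doubled: the pair `(a, b)` of integers stands for the point `(a / 2, b / 2)`. -/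

namespace HexTiling

/-- The points of colour 0, 1, 2 in the barycentric subdivision of the tiling: vertices, midpoints
of edges, and centres of faces. -/
def HasColour : Fin 3 → ℤ × ℤ → Prop
  | 0, p => (Even p.1 ∧ Even p.2) ∧ ¬ (3 ∣ p.1 - p.2)
  | 1, p => ¬ (Even p.1 ∧ Even p.2) ∧ 3 ∣ p.1 - p.2
  | 2, p => (Even p.1 ∧ Even p.2) ∧ 3 ∣ p.1 - p.2

/-- The square of the Euclidean distance in the doubled coordinates (that is, four times the square
of the actual distance). -/
def sqDist (p q : ℤ × ℤ) : ℤ :=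
  (p.1 - q.1) ^ 2 + (p.1 - q.1) * (p.2 - q.2) + (p.2 - q.2) ^ 2

/-- The triple `c` of a vertex, an edge midpoint and a face centre spans a chamber: the actual
distances are vertex to edge midpoint `1 / 2`, edge midpoint to face centre `√3 / 2`, and vertex to
face centre `1`, which says precisely that they are incident with each other. -/
def IsChamber (c : Fin 3 → ℤ × ℤ) : Prop :=
  (∀ i, HasColour i (c i)) ∧ sqDist (c 0) (c 1) = 1 ∧ sqDist (c 1) (c 2) = 3 ∧ sqDist (c 0) (c 2) = 4

end HexTiling

/-! ### Goldberg-Coxeter operations -/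

namespace GC

variable (l m : ℕ)

/-- The corners `v₀ = (l, m)`, `v₁ = ((l - m) / 2, (l + 2 m) / 2)` and `v₂ = (0, 0)` of the triangle
that defines the operation, in doubled coordinates. -/
def corner : Fin 3 → ℤ × ℤ
  | 0 => (2 * l, 2 * m)
  | 1 => (l - m, l + 2 * m)
  | 2 => (0, 0)

/-- The signed area (up to a positive factor) of the triangle spanned by `p`, `q` and `r`. -/
def area (p q r : ℤ × ℤ) : ℤ := (q.1 - p.1) * (r.2 - p.2) - (q.2 - p.2) * (r.1 - p.1)

/-- The (unnormalised) `k`-th barycentric coordinate of `p` with respect to the triangle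
`v₀ v₁ v₂`. It vanishes on the line through the two corners different from `v_k` and is positive
at `v_k`. -/
def bary (k : Fin 3) (p : ℤ × ℤ) : ℤ := area (corner l m (k + 1)) (corner l m (k + 2)) p

/-- The chambers of `GC(l, m)`: the chambers of the barycentric subdivision of the hexagonal tiling
that lie in the closed triangle `v₀ v₁ v₂`. -/
def Chamber : Type :=
  {c : Fin 3 → ℤ × ℤ // HexTiling.IsChamber c ∧ ∀ i k, 0 ≤ bary l m k (c i)}

variable {l m}

/-- `x` and `y` are different chambers with the same edge opposite to their vertices of colour
`i`. -/
def InnerAdj (i : Fin 3) (x y : Chamber l m) : Prop :=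
  x ≠ y ∧ ∀ j, j ≠ i → x.1 j = y.1 j

/-- The edge of `x` opposite to its vertex of colour `i` lies on the side of the triangle opposite
to `v_k`. -/
def OnSide (i k : Fin 3) (x : Chamber l m) : Prop :=
  ∀ j, j ≠ i → bary l m k (x.1 j) = 0

variable (l m)

/-- Applying `GC(l, m)` to a map `P`: a copy of the triangle is glued into every chamber `C` of `P`,
with the corner `v_k` at the vertex of `C` of colour `k`, so that the copies in chambers of `P`
sharing an edge are mirror images of each other in that edge. The chambers of the result are the
pairs `(C, x)`, and this is their `i`-adjacency: either both lie in the same copy and are adjacent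
there, or they are the two copies of a chamber with an edge on a side of the triangle, in chambers
of `P` that are adjacent along that side. -/
def resultAdj {V : Type} (P : RotationMap V) (i : Fin 3) (a b : P.Chamber × Chamber l m) : Prop :=
  (a.1 = b.1 ∧ InnerAdj i a.2 b.2) ∨
    ∃ k, OnSide i k a.2 ∧ P.chamberAdj k a.1 b.1 ∧ a.2 = b.2

/-- `GC(l, m)` increases the symmetry of `P`: the automorphism group of the result is larger than
that of `P`. -/
def IncreasesSymmetry {V : Type} (P : RotationMap V) : Prop :=
  Nat.card (chamberAut P.chamberAdj) < Nat.card (chamberAut (resultAdj l m P))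

/-- `GC(l, m)` can increase symmetry in genus `g`. -/
def CanIncreaseSymmetry (g : ℕ) : Prop :=
  ∃ (V : Type) (_ : Finite V) (P : RotationMap V),
    P.IsPolyhedral ∧ P.HasGenus g ∧ IncreasesSymmetry l m P

end GC

/-! The triangle of the operation has angles of 60, 90 and 30 degrees at `v₀`, `v₁` and `v₂`, and
its sides lie on mirror lines of the subdivided tiling. Since `v₀` is a face centre, the result has
three sorts of faces: a face of `P` of size `s` leaves a face of size `s` at `v₂`, a vertex of
degree `d` becomes a face of size `2 d` at `v₀`, and all other faces are hexagons.

Genus 0: degrees in `P` are at least three, so Euler's formula yields a face of size at most five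
(`exists_small_face`). In the result, faces that small come only from faces of `P`
(`FaceChain.eq_baseChamber`), so an automorphism sends some chamber at a corner `v₂` to a chamber at
a corner `v₂`. Neighbours are unique (`resultAdj.unique`), and the triangle and `P` are connected.
Hence the automorphism permutes whole copies of the triangle without changing positions inside them,
and so comes from an automorphism of `P` (`not_increasesSymmetry`).

Positive genus: two copies of the triangle glued along `v₁ v₂` form an equilateral triangle, one for
each dart of `P`. The result is thus the triangulation by vertices and faces of `P`, with every
triangle filled by the same pattern. As `v₀` and `v₂` are both face centres, this pattern has all
symmetries of the equilateral triangle, so every automorphism of the triangulation acts on the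
result. If `P` is bipartite, an automorphism that exchanges the faces with one colour class of
vertices does not come from `P` (`increasesSymmetry_of_triality`).

The Heawood map on the torus has such an automorphism: black `x` and face `2 - x` are exchanged, and
white `w` goes to `2 - w`. For genus `g`, take its cyclic cover with `g` sheets, totally ramified
over the black vertex `0` and the face `2`. The automorphism exchanges the two branch points and
lifts, and the cover has genus `g` by Riemann–Hurwitz. Polyhedrality rests on `common_edge` and
`isThreeConnected_system`. The voltages are integers, so the finite checks on the 42 darts serve all
`g` at once. -/

namespace HexTiling

/-! ### Chambers of the hexagonal tiling in normal form -/

/-- `u` and `w` are unit vectors that enclose an angle of 60 degrees. -/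
def AdjacentUnits (u₁ u₂ w₁ w₂ : ℤ) : Prop :=
  (u₁ = 1 ∧ u₂ = 0 ∧ w₁ = 0 ∧ w₂ = 1) ∨ (u₁ = 1 ∧ u₂ = 0 ∧ w₁ = 1 ∧ w₂ = -1) ∨
  (u₁ = 0 ∧ u₂ = 1 ∧ w₁ = -1 ∧ w₂ = 1) ∨ (u₁ = 0 ∧ u₂ = 1 ∧ w₁ = 1 ∧ w₂ = 0) ∨
  (u₁ = -1 ∧ u₂ = 1 ∧ w₁ = -1 ∧ w₂ = 0) ∨ (u₁ = -1 ∧ u₂ = 1 ∧ w₁ = 0 ∧ w₂ = 1) ∨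
  (u₁ = -1 ∧ u₂ = 0 ∧ w₁ = 0 ∧ w₂ = -1) ∨ (u₁ = -1 ∧ u₂ = 0 ∧ w₁ = -1 ∧ w₂ = 1) ∨
  (u₁ = 0 ∧ u₂ = -1 ∧ w₁ = 1 ∧ w₂ = -1) ∨ (u₁ = 0 ∧ u₂ = -1 ∧ w₁ = -1 ∧ w₂ = 0) ∨
  (u₁ = 1 ∧ u₂ = -1 ∧ w₁ = 1 ∧ w₂ = 0) ∨ (u₁ = 1 ∧ u₂ = -1 ∧ w₁ = 0 ∧ w₂ = -1)

namespace AdjacentUnits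

variable {u₁ u₂ w₁ w₂ u₁' u₂' w₁' w₂' : ℤ}

theorem swap (h : AdjacentUnits u₁ u₂ w₁ w₂) : AdjacentUnits w₁ w₂ u₁ u₂ := by
  rcases h with h | h | h | h | h | h | h | h | h | h | h | h <;>
  obtain ⟨rfl, rfl, rfl, rfl⟩ := h <;> simp [AdjacentUnits]

theorem reflect (h : AdjacentUnits u₁ u₂ w₁ w₂) :
    AdjacentUnits u₁ u₂ (u₁ - w₁) (u₂ - w₂) := by
  rcases h with h | h | h | h | h | h | h | h | h | h | h | h <;>
  obtain ⟨rfl, rfl, rfl, rfl⟩ := h <;> simp [AdjacentUnits]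

theorem neg_swap (h : AdjacentUnits u₁ u₂ w₁ w₂) : AdjacentUnits (-w₁) (-w₂) (-u₁) (-u₂) := by
  rcases h with h | h | h | h | h | h | h | h | h | h | h | h <;>
  obtain ⟨rfl, rfl, rfl, rfl⟩ := h <;> simp [AdjacentUnits]

theorem exists_sum (h : AdjacentUnits u₁ u₂ w₁ w₂) : ∃ s, u₂ + w₂ = u₁ + w₁ + 3 * s := by
  rcases h with h | h | h | h | h | h | h | h | h | h | h | h <;>
  obtain ⟨rfl, rfl, rfl, rfl⟩ := h <;> first | exact ⟨0, rfl⟩ | exact ⟨1, rfl⟩ | exact ⟨-1, rfl⟩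

theorem of_sum_eq (h : AdjacentUnits u₁ u₂ w₁ w₂) (h' : AdjacentUnits u₁' u₂' w₁' w₂')
    (h₁ : u₁ + w₁ = u₁' + w₁') (h₂ : u₂ + w₂ = u₂' + w₂') :
    u₁' = u₁ ∧ u₂' = u₂ ∨ u₁' = w₁ ∧ u₂' = w₂ := by
  rcases h with h | h | h | h | h | h | h | h | h | h | h | h <;>
  obtain ⟨rfl, rfl, rfl, rfl⟩ := h <;>
  rcases h' with h | h | h | h | h | h | h | h | h | h | h | h <;>
  obtain ⟨rfl, rfl, rfl, rfl⟩ := h <;> simp at h₁ h₂ ⊢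

theorem of_left_eq (h : AdjacentUnits u₁ u₂ w₁ w₂) (h' : AdjacentUnits u₁' u₂' w₁' w₂')
    (h₁ : u₁ = u₁') (h₂ : u₂ = u₂') :
    w₁' = w₁ ∧ w₂' = w₂ ∨ w₁' = u₁ - w₁ ∧ w₂' = u₂ - w₂ := by
  subst h₁ h₂
  rcases h with h | h | h | h | h | h | h | h | h | h | h | h <;>
  obtain ⟨rfl, rfl, rfl, rfl⟩ := h <;> simp [AdjacentUnits] at h' <;> omega

end AdjacentUnits

/-- The chamber at the face centre `(2 a, 2 a + 6 t)` with the vertex in direction `u` and the edge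
midpoint in direction `u + w`. -/
def IsNormalForm (c : Fin 3 → ℤ × ℤ) (a t u₁ u₂ w₁ w₂ : ℤ) : Prop :=
  (c 0).1 = 2 * a + 2 * u₁ ∧ (c 0).2 = 2 * a + 6 * t + 2 * u₂ ∧
  (c 1).1 = 2 * a + u₁ + w₁ ∧ (c 1).2 = 2 * a + 6 * t + u₂ + w₂ ∧
  (c 2).1 = 2 * a ∧ (c 2).2 = 2 * a + 6 * t

theorem unit_cases {x y : ℤ} (h : x ^ 2 + x * y + y ^ 2 = 1) :
    x = 1 ∧ y = 0 ∨ x = 0 ∧ y = 1 ∨ x = -1 ∧ y = 1 ∨ x = -1 ∧ y = 0 ∨ x = 0 ∧ y = -1 ∨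
      x = 1 ∧ y = -1 := by
  have hx : -1 ≤ x ∧ x ≤ 1 := by constructor <;> nlinarith [sq_nonneg (x + 2 * y)]
  have hy : -1 ≤ y ∧ y ≤ 1 := by constructor <;> nlinarith [sq_nonneg (y + 2 * x)]
  obtain ⟨hx1, hx2⟩ := hx
  obtain ⟨hy1, hy2⟩ := hy
  interval_cases x <;> interval_cases y <;> simp_all

/-- Turns the quadratic distance conditions into one of twelve explicit pairs of directions;
afterwards every geometric claim about a chamber is a finite case check in linear arithmetic. -/
theorem IsChamber.exists_normalForm {c : Fin 3 → ℤ × ℤ} (h : IsChamber c) :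
    ∃ a t u₁ u₂ w₁ w₂, AdjacentUnits u₁ u₂ w₁ w₂ ∧ IsNormalForm c a t u₁ u₂ w₁ w₂ := by
  obtain ⟨hcol, h01, h12, h02⟩ := h
  have hc := hcol 2
  obtain ⟨⟨⟨a, ha⟩, ⟨b, hb⟩⟩, hd⟩ := hc
  simp only [sqDist] at h01 h12 h02
  obtain ⟨t, ht⟩ : ∃ t, b = a + 3 * t := ⟨(b - a) / 3, by omega⟩
  have hu := unit_cases h01
  obtain ⟨x, hx⟩ : ∃ x, x = (c 0).1 - (c 1).1 := ⟨_, rfl⟩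
  obtain ⟨y, hy⟩ : ∃ y, y = (c 0).2 - (c 1).2 := ⟨_, rfl⟩
  obtain ⟨z, hz⟩ : ∃ z, z = (c 1).1 - (c 2).1 := ⟨_, rfl⟩
  obtain ⟨w, hw⟩ : ∃ w, w = (c 1).2 - (c 2).2 := ⟨_, rfl⟩
  rw [← hx, ← hy] at hu
  rw [← hz, ← hw] at h12
  rw [show (c 0).1 - (c 2).1 = x + z by omega, show (c 0).2 - (c 2).2 = y + w by omega] at h02
  have key : ∃ u₁ u₂ w₁ w₂, AdjacentUnits u₁ u₂ w₁ w₂ ∧ x + z = 2 * u₁ ∧ y + w = 2 * u₂ ∧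
      z = u₁ + w₁ ∧ w = u₂ + w₂ := by
    have hzb : -2 ≤ z ∧ z ≤ 2 := by constructor <;> nlinarith [sq_nonneg (z + 2 * w)]
    have hwb : -2 ≤ w ∧ w ≤ 2 := by constructor <;> nlinarith [sq_nonneg (w + 2 * z)]
    obtain ⟨hz1, hz2⟩ := hzb
    obtain ⟨hw1, hw2⟩ := hwb
    refine ⟨(x + z) / 2, (y + w) / 2, z - (x + z) / 2, w - (y + w) / 2, ?_⟩
    clear hz hw hx hy
    rcases hu with ⟨rfl, rfl⟩ | ⟨rfl, rfl⟩ | ⟨rfl, rfl⟩ | ⟨rfl, rfl⟩ | ⟨rfl, rfl⟩ | ⟨rfl, rfl⟩ <;>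
    interval_cases z <;> interval_cases w <;> first | omega | simp [AdjacentUnits]
  obtain ⟨u₁, u₂, w₁, w₂, hu, h1, h2, h3, h4⟩ := key
  refine ⟨a, t, u₁, u₂, w₁, w₂, hu, ?_⟩
  unfold IsNormalForm
  omega

theorem IsNormalForm.isChamber {c : Fin 3 → ℤ × ℤ} {a t u₁ u₂ w₁ w₂ : ℤ}
    (h : IsNormalForm c a t u₁ u₂ w₁ w₂) (hu : AdjacentUnits u₁ u₂ w₁ w₂) : IsChamber c := by
  obtain ⟨h1, h2, h3, h4, h5, h6⟩ := h
  refine ⟨?_, ?_⟩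
  · intro i
    fin_cases i <;> simp only [HasColour, Int.even_iff, Fin.mk_zero, Fin.mk_one, Fin.reduceFinMk,
      h1, h2, h3, h4, h5, h6] <;>
    rcases hu with hu | hu | hu | hu | hu | hu | hu | hu | hu | hu | hu | hu <;> omega
  · simp only [sqDist, h1, h2, h3, h4, h5, h6]
    rcases hu with hu | hu | hu | hu | hu | hu | hu | hu | hu | hu | hu | hu <;>
    obtain ⟨rfl, rfl, rfl, rfl⟩ := hu <;> refine ⟨?_, ?_, ?_⟩ <;> ring

/-- The vertex of colour `i` of the chamber on the other side of the edge of `c` opposite to the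
vertex of colour `i`. -/
def opposite (c : Fin 3 → ℤ × ℤ) : Fin 3 → ℤ × ℤ
  | 0 => (2 * (c 1).1 - (c 0).1, 2 * (c 1).2 - (c 0).2)
  | 1 => ((3 * (c 0).1 + (c 2).1) / 2 - (c 1).1, (3 * (c 0).2 + (c 2).2) / 2 - (c 1).2)
  | 2 => (2 * (c 1).1 - (c 2).1, 2 * (c 1).2 - (c 2).2)

theorem IsChamber.update_opposite {c : Fin 3 → ℤ × ℤ} (h : IsChamber c) (i : Fin 3) :
    IsChamber (Function.update c i (opposite c i)) := by
  obtain ⟨a, t, u₁, u₂, w₁, w₂, hu, h1, h2, h3, h4, h5, h6⟩ := h.exists_normalForm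
  fin_cases i
  · refine IsNormalForm.isChamber (a := a) (t := t) (u₁ := w₁) (u₂ := w₂) (w₁ := u₁) (w₂ := u₂)
      ?_ ?_
    · simp [IsNormalForm, opposite]; omega
    · exact hu.swap
  · refine IsNormalForm.isChamber (a := a) (t := t) (u₁ := u₁) (u₂ := u₂) (w₁ := u₁ - w₁)
      (w₂ := u₂ - w₂) ?_ ?_
    · simp [IsNormalForm, opposite]; omega
    · exact hu.reflect
  · obtain ⟨s, hs⟩ := hu.exists_sum
    refine IsNormalForm.isChamber (a := a + u₁ + w₁) (t := t + s) (u₁ := -w₁)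
      (u₂ := -w₂) (w₁ := -u₁) (w₂ := -u₂) ?_ ?_
    · simp [IsNormalForm, opposite]; omega
    · exact hu.neg_swap

/-- At most two chambers share an edge. -/
theorem IsChamber.eq_opposite {c d : Fin 3 → ℤ × ℤ} (hc : IsChamber c) (hd : IsChamber d)
    {i : Fin 3} (h : ∀ j, j ≠ i → c j = d j) (hne : c i ≠ d i) : d i = opposite c i := by
  obtain ⟨a, t, u₁, u₂, w₁, w₂, hu, h1, h2, h3, h4, h5, h6⟩ := hc.exists_normalForm
  obtain ⟨a', t', u₁', u₂', w₁', w₂', hu', h1', h2', h3', h4', h5', h6'⟩ := hd.exists_normalForm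
  have g := fun j hj => Prod.ext_iff.1 (h j hj)
  have hne' : ¬ ((c i).1 = (d i).1 ∧ (c i).2 = (d i).2) := fun h => hne (Prod.ext_iff.2 h)
  apply Prod.ext_iff.2
  fin_cases i
  · have g1 := g 1 (by decide)
    have g2 := g 2 (by decide)
    simp only [opposite, Fin.mk_zero] at hne' ⊢
    have := hu.of_sum_eq hu' (by omega) (by omega)
    omega
  · have g1 := g 0 (by decide)
    have g2 := g 2 (by decide)
    simp only [opposite, Fin.mk_one] at hne' ⊢
    have := hu.of_left_eq hu' (by omega) (by omega)
    omega
  · have g1 := g 0 (by decide)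
    have g2 := g 1 (by decide)
    simp only [opposite, Fin.reduceFinMk] at hne' ⊢
    have := hu.swap.reflect.swap.of_left_eq (hu'.swap.reflect.swap) (by omega) (by omega)
    omega

theorem IsChamber.opposite_ne {c : Fin 3 → ℤ × ℤ} (hc : IsChamber c) (i : Fin 3) :
    opposite c i ≠ c i := by
  obtain ⟨a, t, u₁, u₂, w₁, w₂, hu, h1, h2, h3, h4, h5, h6⟩ := hc.exists_normalForm
  intro h
  obtain ⟨g, g'⟩ := Prod.ext_iff.1 h
  clear h
  fin_cases i <;> simp only [opposite, Fin.mk_zero, Fin.mk_one, Fin.reduceFinMk] at g g' <;>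
  rcases hu with hu | hu | hu | hu | hu | hu | hu | hu | hu | hu | hu | hu <;> omega

end HexTiling

/-! ### The triangle of the operation and uniqueness of neighbours -/

namespace GC

open HexTiling

/-- The barycentric coordinates up to a positive factor. -/
def sideForm (l m : ℕ) : Fin 3 → ℤ × ℤ → ℤ
  | 0, p => if m = 0 then p.1 - p.2 else p.1
  | 1, p => if m = 0 then p.2 else p.2 - p.1
  | 2, p => if m = 0 then 2 * l - p.1 - p.2 else 6 * l - p.1 - 2 * p.2

/-- The barycentric coordinates contain products with `l`. Dividing out this positive factor leaves
forms with constant coefficients, to which linear arithmetic applies. -/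
theorem bary_eq {l m : ℕ} (hl : 0 < l) (hlm : l = m ∨ m = 0) (k : Fin 3) :
    ∃ r : ℤ, 0 < r ∧ ∀ p, bary l m k p = r * sideForm l m k p := by
  have hl' : (0 : ℤ) < l := by exact_mod_cast hl
  rcases hlm with rfl | rfl
  · have : l ≠ 0 := by omega
    fin_cases k
    · refine ⟨3 * l, by omega, fun p => ?_⟩
      simp [bary, area, corner, sideForm, this]; ring
    · refine ⟨2 * l, by omega, fun p => ?_⟩
      simp [bary, area, corner, sideForm, this]; ring
    · refine ⟨l, by omega, fun p => ?_⟩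
      simp [bary, area, corner, sideForm, this]; ring
  · fin_cases k
    · refine ⟨l, by omega, fun p => ?_⟩
      simp [bary, area, corner, sideForm]; ring
    · refine ⟨2 * l, by omega, fun p => ?_⟩
      simp [bary, area, corner, sideForm]
    · refine ⟨l, by omega, fun p => ?_⟩
      simp [bary, area, corner, sideForm]; ring

variable {l m : ℕ} (hl : 0 < l) (hlm : l = m ∨ m = 0)

theorem bary_nonneg_iff (hl : 0 < l) (hlm : l = m ∨ m = 0) (k : Fin 3) (p : ℤ × ℤ) :
    0 ≤ bary l m k p ↔ 0 ≤ sideForm l m k p := by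
  obtain ⟨r, hr, h⟩ := bary_eq hl hlm k
  rw [h, mul_nonneg_iff_of_pos_left hr]

theorem bary_eq_zero_iff (hl : 0 < l) (hlm : l = m ∨ m = 0) (k : Fin 3) (p : ℤ × ℤ) :
    bary l m k p = 0 ↔ sideForm l m k p = 0 := by
  obtain ⟨r, hr, h⟩ := bary_eq hl hlm k
  rw [h, mul_eq_zero, or_iff_right hr.ne']

end GC

namespace GC

open HexTiling

variable {l m : ℕ}

theorem Chamber.sideForm_nonneg (hl : 0 < l) (hlm : l = m ∨ m = 0) (x : Chamber l m)
    (i k : Fin 3) : 0 ≤ sideForm l m k (x.1 i) :=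
  (bary_nonneg_iff hl hlm k _).1 (x.2.2 i k)

theorem OnSide.sideForm_eq_zero (hl : 0 < l) (hlm : l = m ∨ m = 0) {x : Chamber l m} {i k : Fin 3}
    (h : OnSide i k x) {j : Fin 3} (hj : j ≠ i) : sideForm l m k (x.1 j) = 0 :=
  (bary_eq_zero_iff hl hlm k _).1 (h j hj)

/-- A side that contains an edge of a chamber is a mirror line, and the chamber across that edge is
the mirror image. -/
theorem sideForm_opposite {c : Fin 3 → ℤ × ℤ} (hc : IsChamber c) {i k : Fin 3}
    (h : ∀ j, j ≠ i → sideForm l m k (c j) = 0) :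
    sideForm l m k (opposite c i) = -sideForm l m k (c i) := by
  obtain ⟨a, t, u₁, u₂, w₁, w₂, -, h1, h2, h3, h4, h5, h6⟩ := hc.exists_normalForm
  have g0 := h 0
  have g1 := h 1
  have g2 := h 2
  clear h hc
  by_cases hm : m = 0 <;> fin_cases i <;> fin_cases k <;>
  simp [sideForm, opposite, hm] at g0 g1 g2 ⊢ <;> omega

theorem sideForm_nondegenerate {c : Fin 3 → ℤ × ℤ} (hc : IsChamber c) (k : Fin 3) :
    ¬ ∀ j, sideForm l m k (c j) = 0 := by
  obtain ⟨a, t, u₁, u₂, w₁, w₂, hu, h1, h2, h3, h4, h5, h6⟩ := hc.exists_normalForm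
  intro h
  have g0 := h 0
  have g1 := h 1
  have g2 := h 2
  clear h hc
  by_cases hm : m = 0 <;> fin_cases k <;> simp [sideForm, hm] at g0 g1 g2 <;>
  rcases hu with hu | hu | hu | hu | hu | hu | hu | hu | hu | hu | hu | hu <;> omega

theorem eq_of_sideForm_eq_zero {p q : ℤ × ℤ} {k k' : Fin 3} (hk : k ≠ k')
    (hp : sideForm l m k p = 0) (hp' : sideForm l m k' p = 0)
    (hq : sideForm l m k q = 0) (hq' : sideForm l m k' q = 0) : p = q := by
  apply Prod.ext_iff.2
  by_cases hm : m = 0 <;> fin_cases k <;> fin_cases k' <;>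
  simp [sideForm, hm] at hk hp hp' hq hq' <;> omega

end GC

namespace HexTiling

theorem IsChamber.injective {c : Fin 3 → ℤ × ℤ} (hc : IsChamber c) : Function.Injective c := by
  obtain ⟨a, t, u₁, u₂, w₁, w₂, hu, h1, h2, h3, h4, h5, h6⟩ := hc.exists_normalForm
  intro i j h
  obtain ⟨g, g'⟩ := Prod.ext_iff.1 h
  clear h hc
  fin_cases i <;> fin_cases j <;> simp at g g' ⊢ <;>
  rcases hu with hu | hu | hu | hu | hu | hu | hu | hu | hu | hu | hu | hu <;> omega

end HexTiling

namespace GC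

open HexTiling

variable {l m : ℕ}

theorem InnerAdj.apply_ne {i : Fin 3} {x y : Chamber l m} (h : InnerAdj i x y) :
    x.1 i ≠ y.1 i := by
  intro he
  apply h.1
  apply Subtype.ext
  funext j
  by_cases hj : j = i
  · rw [hj, he]
  · exact h.2 j hj

theorem InnerAdj.eq_opposite {i : Fin 3} {x y : Chamber l m} (h : InnerAdj i x y) :
    y.1 i = opposite x.1 i :=
  x.2.1.eq_opposite y.2.1 h.2 h.apply_ne

theorem InnerAdj.unique {i : Fin 3} {x y z : Chamber l m} (h : InnerAdj i x y)
    (h' : InnerAdj i x z) : y = z := by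
  apply Subtype.ext
  funext j
  by_cases hj : j = i
  · rw [hj, h.eq_opposite, h'.eq_opposite]
  · rw [← h.2 j hj, h'.2 j hj]

theorem InnerAdj.symm {i : Fin 3} {x y : Chamber l m} (h : InnerAdj i x y) : InnerAdj i y x :=
  ⟨h.1.symm, fun j hj => (h.2 j hj).symm⟩

/-- The neighbour across an edge on a side would be the reflection in that side, and so would leave
the triangle. Thus gluing between copies never competes with adjacency inside a copy. -/
theorem InnerAdj.not_onSide (hl : 0 < l) (hlm : l = m ∨ m = 0) {i k : Fin 3} {x y : Chamber l m}
    (h : InnerAdj i x y) : ¬ OnSide i k x := by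
  intro hs
  have h1 := sideForm_opposite x.2.1 (fun j hj => hs.sideForm_eq_zero hl hlm hj)
  have h2 := x.sideForm_nonneg hl hlm i k
  have h3 := y.sideForm_nonneg hl hlm i k
  rw [h.eq_opposite] at h3
  refine sideForm_nondegenerate (l := l) (m := m) x.2.1 k fun j => ?_
  by_cases hj : j = i
  · subst hj; omega
  · exact hs.sideForm_eq_zero hl hlm hj

theorem OnSide.unique (hl : 0 < l) (hlm : l = m ∨ m = 0) {i k k' : Fin 3} {x : Chamber l m}
    (h : OnSide i k x) (h' : OnSide i k' x) : k = k' := by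
  by_contra hk
  have hne : i + 1 ≠ i + 2 := (by decide : ∀ i : Fin 3, i + 1 ≠ i + 2) i
  apply hne
  apply x.2.1.injective
  have h1 : i + 1 ≠ i := (by decide : ∀ i : Fin 3, i + 1 ≠ i) i
  have h2 : i + 2 ≠ i := (by decide : ∀ i : Fin 3, i + 2 ≠ i) i
  exact eq_of_sideForm_eq_zero hk (h.sideForm_eq_zero hl hlm h1) (h'.sideForm_eq_zero hl hlm h1)
    (h.sideForm_eq_zero hl hlm h2) (h'.sideForm_eq_zero hl hlm h2)

/-- In the result of the operation every chamber has at most one `i`-neighbour. -/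
theorem resultAdj.unique (hl : 0 < l) (hlm : l = m ∨ m = 0) {V : Type} {P : RotationMap V}
    {i : Fin 3} {a b c : P.Chamber × Chamber l m} (h : resultAdj l m P i a b)
    (h' : resultAdj l m P i a c) : b = c := by
  rcases h with ⟨h1, h2⟩ | ⟨k, h1, h2, h3⟩ <;> rcases h' with ⟨h1', h2'⟩ | ⟨k', h1', h2', h3'⟩
  · exact Prod.ext (h1.symm.trans h1') (h2.unique h2')
  · exact absurd h1' (h2.not_onSide hl hlm)
  · exact absurd h1 (h2'.not_onSide hl hlm)
  · obtain rfl := h1.unique hl hlm h1'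
    exact Prod.ext (h2.symm.trans h2') (h3.symm.trans h3')

/-- The chamber at the corner `v₂`. -/
def baseTriple (m : ℕ) : Fin 3 → ℤ × ℤ
  | 0 => if m = 0 then (2, 0) else (0, 2)
  | 1 => (1, 1)
  | 2 => (0, 0)

theorem isChamber_baseTriple (m : ℕ) : IsChamber (baseTriple m) := by
  by_cases hm : m = 0
  · exact IsNormalForm.isChamber (a := 0) (t := 0) (u₁ := 1) (u₂ := 0) (w₁ := 0) (w₂ := 1)
      (by simp [IsNormalForm, baseTriple, hm]) (by simp [AdjacentUnits])
  · exact IsNormalForm.isChamber (a := 0) (t := 0) (u₁ := 0) (u₂ := 1) (w₁ := 1) (w₂ := 0)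
      (by simp [IsNormalForm, baseTriple, hm]) (by simp [AdjacentUnits])

/-- A chamber of the tiling all of whose vertices satisfy the inequalities of the triangle. -/
def Chamber.ofSideForm (hl : 0 < l) (hlm : l = m ∨ m = 0) (c : Fin 3 → ℤ × ℤ) (hc : IsChamber c)
    (h : ∀ i k, 0 ≤ sideForm l m k (c i)) : Chamber l m :=
  ⟨c, hc, fun i k => (bary_nonneg_iff hl hlm k _).2 (h i k)⟩

def baseChamber (hl : 0 < l) (hlm : l = m ∨ m = 0) : Chamber l m :=
  .ofSideForm hl hlm (baseTriple m) (isChamber_baseTriple m) (by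
    intro i k
    by_cases hm : m = 0 <;> fin_cases i <;> fin_cases k <;>
    simp [sideForm, baseTriple, hm] <;> omega)

/-- The angle at `v₂` is 30 degrees, exactly one twelfth of a hexagon. -/
theorem eq_baseChamber (hl : 0 < l) (hlm : l = m ∨ m = 0) {x : Chamber l m}
    (h : x.1 2 = (0, 0)) : x = baseChamber hl hlm := by
  have h10 := x.sideForm_nonneg hl hlm 1 0
  have h11 := x.sideForm_nonneg hl hlm 1 1
  have h00 := x.sideForm_nonneg hl hlm 0 0
  have h01 := x.sideForm_nonneg hl hlm 0 1
  obtain ⟨a, t, u₁, u₂, w₁, w₂, hu, h1, h2, h3, h4, h5, h6⟩ := x.2.1.exists_normalForm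
  rw [h] at h5 h6
  simp only at h5 h6
  apply Subtype.ext
  change x.1 = baseTriple m
  have key : (x.1 0).1 = (baseTriple m 0).1 ∧ (x.1 0).2 = (baseTriple m 0).2 ∧ (x.1 1).1 = 1 ∧
      (x.1 1).2 = 1 := by
    clear h
    by_cases hm : m = 0 <;> simp [sideForm, baseTriple, hm] at h10 h11 h00 h01 ⊢ <;>
    rcases hu with hu | hu | hu | hu | hu | hu | hu | hu | hu | hu | hu | hu <;> omega
  funext i
  fin_cases i
  · exact Prod.ext_iff.2 ⟨key.1, key.2.1⟩
  · exact Prod.ext_iff.2 key.2.2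
  · exact h

/-- Every side of the triangle contains an edge of the barycentric subdivision. -/
theorem exists_onSide (hl : 0 < l) (hlm : l = m ∨ m = 0) (h3 : m = 0 → 3 ∣ l) (k : Fin 3) :
    ∃ (i : Fin 3) (x : Chamber l m), OnSide i k x := by
  by_cases hm : m = 0
  · obtain ⟨r, hr⟩ := h3 hm
    -- For the side `v₀ v₁` a chamber at the corner `v₀` is taken. Divisibility of `l` by three is
    -- what makes that corner a face centre.
    have key : IsNormalForm
        (![(2 * (l : ℤ) - 2, 2), (2 * (l : ℤ) - 2, 1), (2 * (l : ℤ), 0)]) l (-r) (-1) 1 (-1) 0 := by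
      simp [IsNormalForm]; omega
    let z : Chamber l m := .ofSideForm hl hlm _ (key.isChamber (by simp [AdjacentUnits])) (by
      intro i k
      fin_cases i <;> fin_cases k <;> simp [sideForm, hm] <;> omega)
    fin_cases k
    · refine ⟨0, baseChamber hl hlm, fun j hj => (bary_eq_zero_iff hl hlm _ _).2 ?_⟩
      fin_cases j <;> simp_all [baseChamber, Chamber.ofSideForm, sideForm, baseTriple]
    · refine ⟨1, baseChamber hl hlm, fun j hj => (bary_eq_zero_iff hl hlm _ _).2 ?_⟩
      fin_cases j <;> simp_all [baseChamber, Chamber.ofSideForm, sideForm, baseTriple]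
    · refine ⟨1, z, fun j hj => (bary_eq_zero_iff hl hlm _ _).2 ?_⟩
      fin_cases j <;> simp_all [z, Chamber.ofSideForm, sideForm]
  · have hlm' : m = l := by omega
    have key : IsNormalForm
        (![(2 * (l : ℤ) - 2, 2 * l), (2 * (l : ℤ) - 2, 2 * l + 1), (2 * (l : ℤ), 2 * l)]) l 0
        (-1) 0 (-1) 1 := by
      simp [IsNormalForm]; omega
    let z : Chamber l m := .ofSideForm hl hlm _ (key.isChamber (by simp [AdjacentUnits])) (by
      intro i k
      fin_cases i <;> fin_cases k <;> simp [sideForm, hm] <;> omega)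
    fin_cases k
    · refine ⟨1, baseChamber hl hlm, fun j hj => (bary_eq_zero_iff hl hlm _ _).2 ?_⟩
      fin_cases j <;> simp_all [baseChamber, Chamber.ofSideForm, sideForm, baseTriple]
      omega
    · refine ⟨0, baseChamber hl hlm, fun j hj => (bary_eq_zero_iff hl hlm _ _).2 ?_⟩
      fin_cases j <;> simp_all [baseChamber, Chamber.ofSideForm, sideForm, baseTriple]
      omega
    · refine ⟨0, z, fun j hj => (bary_eq_zero_iff hl hlm _ _).2 ?_⟩
      fin_cases j <;> simp_all [z, Chamber.ofSideForm, sideForm] <;> omega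

end GC

/-! ### Connectedness of the triangle -/

namespace GC

open HexTiling

variable {l m : ℕ}

/-- The squared distance of the centroids of a chamber and the base chamber, up to a factor. -/
def baseDist (m : ℕ) (c : Fin 3 → ℤ × ℤ) : ℤ :=
  sqDist ((c 0).1 + (c 1).1 + (c 2).1, (c 0).2 + (c 1).2 + (c 2).2)
    (if m = 0 then (3, 1) else (1, 3))

theorem sqDist_nonneg (p q : ℤ × ℤ) : 0 ≤ sqDist p q := by
  unfold sqDist
  nlinarith [sq_nonneg ((p.1 - q.1) + 2 * (p.2 - q.2)), sq_nonneg (p.1 - q.1)]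

theorem innerAdj_of_opposite (hl : 0 < l) (hlm : l = m ∨ m = 0) (x : Chamber l m) (i : Fin 3)
    (h : ∀ k, 0 ≤ sideForm l m k (opposite x.1 i)) :
    ∃ y : Chamber l m, InnerAdj i x y ∧ y.1 = Function.update x.1 i (opposite x.1 i) := by
  refine ⟨.ofSideForm hl hlm _ (x.2.1.update_opposite i) fun j k => ?_, ⟨?_, fun j hj => ?_⟩, rfl⟩
  · by_cases hj : j = i
    · subst hj; simpa using h k
    · simpa [hj] using x.sideForm_nonneg hl hlm j k
  · intro he
    have := congrFun (congrArg Subtype.val he) i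
    simp [Chamber.ofSideForm] at this
    exact x.2.1.opposite_ne i this.symm
  · simp [Chamber.ofSideForm, hj]

/-- Chambers are cut out by mirror lines. A wall of `x` that separates it from the base chamber
cannot be a side of the triangle, since both chambers lie inside; reflecting in this wall stays in
the triangle and brings the centroid closer to that of the base chamber. -/
theorem exists_closer (hl : 0 < l) (hlm : l = m ∨ m = 0) {x : Chamber l m}
    (hx : x ≠ baseChamber hl hlm) :
    ∃ (i : Fin 3) (y : Chamber l m), InnerAdj i x y ∧ baseDist m y.1 < baseDist m x.1 := by
  by_contra! hcon
  apply hx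
  apply eq_baseChamber
  have key : ∀ i, (∀ k, 0 ≤ sideForm l m k (opposite x.1 i)) →
      baseDist m x.1 ≤ baseDist m (Function.update x.1 i (opposite x.1 i)) := by
    intro i h
    obtain ⟨y, hy, he⟩ := innerAdj_of_opposite hl hlm x i h
    exact he ▸ hcon i y hy
  have k0 := key 0
  have k1 := key 1
  have k2 := key 2
  have f := x.sideForm_nonneg hl hlm
  obtain ⟨a, t, u₁, u₂, w₁, w₂, hu, h1, h2, h3, h4, h5, h6⟩ := x.2.1.exists_normalForm
  clear key hcon hx
  have o1 : opposite x.1 1 = (2 * a + 2 * u₁ - w₁, 2 * a + 6 * t + 2 * u₂ - w₂) := by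
    simp only [opposite, Prod.ext_iff]; omega
  have o0 : opposite x.1 0 = (2 * a + 2 * w₁, 2 * a + 6 * t + 2 * w₂) := by
    simp only [opposite, Prod.ext_iff]; omega
  have o2 : opposite x.1 2 = (2 * a + 2 * (u₁ + w₁), 2 * a + 6 * t + 2 * (u₂ + w₂)) := by
    simp only [opposite, Prod.ext_iff]; omega
  apply Prod.ext_iff.2
  by_cases hm : m = 0 <;>
  simp [Fin.forall_fin_succ, sideForm, baseDist, sqDist, o0, o1, o2, hm, h1, h2, h3, h4, h5, h6]
    at f k0 k1 k2 ⊢ <;>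
  rcases hu with hu | hu | hu | hu | hu | hu | hu | hu | hu | hu | hu | hu <;>
  obtain ⟨rfl, rfl, rfl, rfl⟩ := hu <;>
  ring_nf at k0 k1 k2 <;> omega

end GC

namespace GC

open HexTiling

variable {l m : ℕ}

/-- The triangle is connected. -/
theorem forall_of_innerAdj (hl : 0 < l) (hlm : l = m ∨ m = 0) {p : Chamber l m → Prop}
    (hp : ∀ i x y, InnerAdj i x y → p x → p y) {x : Chamber l m} (hx : p x) (y : Chamber l m) :
    p y := by
  have key : ∀ (n : ℕ) (z : Chamber l m), (baseDist m z.1).toNat < n →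
      (p z ↔ p (baseChamber hl hlm)) := by
    intro n
    induction n with
    | zero => intro z hz; omega
    | succ n ih =>
      intro z hz
      by_cases hb : z = baseChamber hl hlm
      · rw [hb]
      · obtain ⟨i, w, hw, hd⟩ := exists_closer hl hlm hb
        have h0 : 0 ≤ baseDist m w.1 := sqDist_nonneg _ _
        rw [← ih w (by omega)]
        exact ⟨hp i z w hw, hp i w z hw.symm⟩
  exact (key _ y (Nat.lt_succ_self _)).2 ((key _ x (Nat.lt_succ_self _)).1 hx)

/-! ### Lower bounds for the sizes of new faces -/

/-- `b` is obtained from `a` by moving `s` times across an edge of colour `0` and then one of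
colour `1`. -/
def FaceChain {X : Type} (adj : Fin 3 → X → X → Prop) : ℕ → X → X → Prop
  | 0, a, b => a = b
  | s + 1, a, c => ∃ b b', adj 0 a b ∧ adj 1 b b' ∧ FaceChain adj s b' c

theorem FaceChain.map {X : Type} {adj : Fin 3 → X → X → Prop} {σ : X → X}
    (hσ : ∀ i x y, adj i x y → adj i (σ x) (σ y)) {s : ℕ} {a b : X} (h : FaceChain adj s a b) :
    FaceChain adj s (σ a) (σ b) := by
  induction s generalizing a with
  | zero => exact congrArg σ h
  | succ s ih =>
    obtain ⟨c, d, h1, h2, h3⟩ := h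
    exact ⟨σ c, σ d, hσ _ _ _ h1, hσ _ _ _ h2, ih h3⟩

theorem FaceChain.iterate_eq {X Y : Type} {adj : Fin 3 → X → X → Prop} {I : X → Prop} {f : X → Y}
    {g : Y → Y} (h : ∀ a b c, I a → adj 0 a b → adj 1 b c → I c ∧ f c = g (f a)) {s : ℕ} {a b : X}
    (ha : I a) (hc : FaceChain adj s a b) : f b = g^[s] (f a) := by
  induction s generalizing a with
  | zero => exact congrArg f hc.symm
  | succ s ih =>
    obtain ⟨c, d, h1, h2, h3⟩ := hc
    obtain ⟨hd, he⟩ := h a c d ha h1 h2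
    rw [ih hd h3, he, Function.iterate_succ_apply]

/-- A chain at which a rotation by 60 degrees can be read off is not closed after less than six
steps. -/
theorem FaceChain.eq_zero {X : Type} {adj : Fin 3 → X → X → Prop} {I : X → Prop} {f g : X → ℤ}
    (h0 : ∀ a b, I a → adj 0 a b → I b ∧ f b = g a ∧ g b = f a)
    (h1 : ∀ a b, I a → adj 1 a b → I b ∧ f b = f a ∧ g b = f a - g a) {s : ℕ} (hs : 0 < s)
    (hs' : s ≤ 5) {a : X} (ha : I a) (hc : FaceChain adj s a a) : f a = 0 ∧ g a = 0 := by
  -- One step acts on the pair of readings by a matrix of order six with primitive sixth roots of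
  -- unity as eigenvalues, so its powers 1 to 5 fix only zero.
  have key := hc.iterate_eq (f := fun a => (f a, g a)) (g := fun p : ℤ × ℤ => (p.2, p.2 - p.1))
    (fun a b c ha hab hbc => by
      obtain ⟨hb, h2, h3⟩ := h0 a b ha hab
      obtain ⟨hc, h4, h5⟩ := h1 b c hb hbc
      refine ⟨hc, ?_⟩
      simp only [h4, h5, h2, h3]) ha
  interval_cases s <;> simp at key <;> omega

/-- A linear form that is constant on the lines perpendicular to the side opposite to `v_k`. -/
def tangent (m : ℕ) : Fin 3 → ℤ × ℤ → ℤ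
  | 0, p => if m = 0 then p.1 + p.2 else p.1 + 2 * p.2
  | 1, p => if m = 0 then 2 * p.1 + p.2 else p.1 + p.2
  | 2, p => if m = 0 then p.1 - p.2 else p.1

/-- The tangential component of the direction from the face to the vertex of a chamber. -/
def tangentU (k : Fin 3) (x : Chamber l m) : ℤ := tangent m k (x.1 0) - tangent m k (x.1 2)

/-- The tangential component of the direction from the face to the other vertex of the edge of a
chamber. -/
def tangentW (k : Fin 3) (x : Chamber l m) : ℤ :=
  2 * tangent m k (x.1 1) - tangent m k (x.1 0) - tangent m k (x.1 2)

theorem tangent_innerAdj_zero (k : Fin 3) {x y : Chamber l m} (h : InnerAdj 0 x y) :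
    tangentU k y = tangentW k x ∧ tangentW k y = tangentU k x := by
  unfold tangentU tangentW
  rw [h.eq_opposite, ← h.2 1 (by decide), ← h.2 2 (by decide)]
  by_cases hm : m = 0 <;> fin_cases k <;> simp [tangent, hm, opposite] <;> omega

/-- The vertex `u` of the hexagon stays, and its neighbour `w` is replaced by the other neighbour `u
- w`. -/
theorem tangent_innerAdj_one (k : Fin 3) {x y : Chamber l m} (h : InnerAdj 1 x y) :
    tangentU k y = tangentU k x ∧ tangentW k y = tangentU k x - tangentW k x := by
  unfold tangentU tangentW
  rw [h.eq_opposite, ← h.2 0 (by decide), ← h.2 2 (by decide)]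
  obtain ⟨a, t, u₁, u₂, w₁, w₂, hu, h1, h2, h3, h4, h5, h6⟩ := x.2.1.exists_normalForm
  have o1 : opposite x.1 1 = (2 * a + 2 * u₁ - w₁, 2 * a + 6 * t + 2 * u₂ - w₂) := by
    simp only [opposite, Prod.ext_iff]; omega
  by_cases hm : m = 0 <;> fin_cases k <;> simp [tangent, hm, o1] <;> omega

/-- The side passes through the face centre and the edge midpoint, so reflecting in it exchanges the
two ends of the edge and preserves tangential components. Crossing the side therefore acts on the
readings exactly like an inner step. -/
theorem tangent_onSide_zero (hl : 0 < l) (hlm : l = m ∨ m = 0) (k : Fin 3) {x : Chamber l m}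
    (h : OnSide 0 k x) : tangentU k x = tangentW k x := by
  have g1 := h.sideForm_eq_zero hl hlm (j := 1) (by decide)
  have g2 := h.sideForm_eq_zero hl hlm (j := 2) (by decide)
  unfold tangentU tangentW
  obtain ⟨a, t, u₁, u₂, w₁, w₂, hu, h1, h2, h3, h4, h5, h6⟩ := x.2.1.exists_normalForm
  by_cases hm : m = 0 <;> fin_cases k <;>
  simp [tangent, sideForm, hm, h1, h2, h3, h4, h5, h6] at g1 g2 ⊢ <;>
  rcases hu with hu | hu | hu | hu | hu | hu | hu | hu | hu | hu | hu | hu <;> omega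

/-- Here the side passes through the face centre and the vertex, and the reflection exchanges `w`
with `u - w`. -/
theorem tangent_onSide_one (hl : 0 < l) (hlm : l = m ∨ m = 0) (k : Fin 3) {x : Chamber l m}
    (h : OnSide 1 k x) : tangentU k x = 2 * tangentW k x := by
  have g1 := h.sideForm_eq_zero hl hlm (j := 0) (by decide)
  have g2 := h.sideForm_eq_zero hl hlm (j := 2) (by decide)
  unfold tangentU tangentW
  obtain ⟨a, t, u₁, u₂, w₁, w₂, hu, h1, h2, h3, h4, h5, h6⟩ := x.2.1.exists_normalForm
  by_cases hm : m = 0 <;> fin_cases k <;>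
  simp [tangent, sideForm, hm, h1, h2, h3, h4, h5, h6] at g1 g2 ⊢ <;>
  rcases hu with hu | hu | hu | hu | hu | hu | hu | hu | hu | hu | hu | hu <;> omega

/-- The sides opposite to `v₀` and `v₂` are perpendicular, so reflecting in the second one negates
the component along the first. -/
theorem tangent_onSide_zero_two (hl : 0 < l) (hlm : l = m ∨ m = 0) {x : Chamber l m}
    (h : OnSide 0 2 x) : tangentU 0 x = -tangentW 0 x := by
  have g1 := h.sideForm_eq_zero hl hlm (j := 1) (by decide)
  have g2 := h.sideForm_eq_zero hl hlm (j := 2) (by decide)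
  unfold tangentU tangentW
  obtain ⟨a, t, u₁, u₂, w₁, w₂, hu, h1, h2, h3, h4, h5, h6⟩ := x.2.1.exists_normalForm
  by_cases hm : m = 0 <;>
  simp [tangent, sideForm, hm, h1, h2, h3, h4, h5, h6] at g1 g2 ⊢ <;> omega

theorem tangent_onSide_one_two (hl : 0 < l) (hlm : l = m ∨ m = 0) {x : Chamber l m}
    (h : OnSide 1 2 x) : tangentU 0 x = 0 := by
  have g1 := h.sideForm_eq_zero hl hlm (j := 0) (by decide)
  have g2 := h.sideForm_eq_zero hl hlm (j := 2) (by decide)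
  unfold tangentU
  by_cases hm : m = 0 <;> simp [tangent, sideForm, hm] at g1 g2 ⊢ <;> omega

/-- The directions `u` and `w` are linearly independent, so they are not both perpendicular to the
side. -/
theorem tangent_nondegenerate (k : Fin 3) (x : Chamber l m) :
    ¬ (tangentU k x = 0 ∧ tangentW k x = 0) := by
  unfold tangentU tangentW
  obtain ⟨a, t, u₁, u₂, w₁, w₂, hu, h1, h2, h3, h4, h5, h6⟩ := x.2.1.exists_normalForm
  by_cases hm : m = 0 <;> fin_cases k <;>
  simp [tangent, hm, h1, h2, h3, h4, h5, h6] <;>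
  rcases hu with hu | hu | hu | hu | hu | hu | hu | hu | hu | hu | hu | hu <;> omega

variable {V : Type} {P : RotationMap V}

/-- A face whose centre is on the side opposite to `v₁`, but not at a corner, has size at least
six. -/
theorem not_faceChain_of_side_one (hl : 0 < l) (hlm : l = m ∨ m = 0)
    {a : P.Chamber × Chamber l m} (h0 : sideForm l m 0 (a.2.1 2) ≠ 0)
    (h2 : sideForm l m 2 (a.2.1 2) ≠ 0) {s : ℕ} (hs : 0 < s) (hs' : s ≤ 5) :
    ¬ FaceChain (resultAdj l m P) s a a := by
  intro hc
  have hside : ∀ {i k : Fin 3} {x : Chamber l m}, i ≠ 2 → x.1 2 = a.2.1 2 → OnSide i k x →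
      k = 1 := by
    intro i k x hi hx h
    have := h.sideForm_eq_zero hl hlm (Ne.symm hi)
    rw [hx] at this
    fin_cases k
    · exact absurd this h0
    · rfl
    · exact absurd this h2
  refine tangent_nondegenerate 1 a.2 (FaceChain.eq_zero
    (I := fun b : P.Chamber × Chamber l m => b.2.1 2 = a.2.1 2) (f := fun b => tangentU 1 b.2)
    (g := fun b => tangentW 1 b.2) ?_ ?_ hs hs' rfl hc)
  · rintro ⟨C, x⟩ ⟨D, y⟩ hx (⟨-, h⟩ | ⟨k, h, -, rfl⟩)
    · exact ⟨(h.2 2 (by decide)).symm.trans hx, tangent_innerAdj_zero 1 h⟩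
    · obtain rfl := hside (by decide) hx h
      have := tangent_onSide_zero hl hlm 1 h
      exact ⟨hx, this, this.symm⟩
  · rintro ⟨C, x⟩ ⟨D, y⟩ hx (⟨-, h⟩ | ⟨k, h, -, rfl⟩)
    · exact ⟨(h.2 2 (by decide)).symm.trans hx, tangent_innerAdj_one 1 h⟩
    · obtain rfl := hside (by decide) hx h
      have := tangent_onSide_one hl hlm 1 h
      dsimp only at this ⊢
      exact ⟨hx, rfl, by omega⟩

open Classical in
/-- A face whose centre is not on the side opposite to `v₁` has size at least six. -/
theorem not_faceChain_of_not_side_one (hl : 0 < l) (hlm : l = m ∨ m = 0)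
    {a : P.Chamber × Chamber l m} (h1 : sideForm l m 1 (a.2.1 2) ≠ 0) {s : ℕ} (hs : 0 < s)
    (hs' : s ≤ 5) : ¬ FaceChain (resultAdj l m P) s a a := by
  intro hc
  have hside : ∀ {i k : Fin 3} {x : Chamber l m}, i ≠ 2 → x.1 2 = a.2.1 2 → OnSide i k x →
      k = 0 ∨ k = 2 := by
    intro i k x hi hx h
    have := h.sideForm_eq_zero hl hlm (Ne.symm hi)
    rw [hx] at this
    fin_cases k
    · exact Or.inl rfl
    · exact absurd this h1
    · exact Or.inr rfl
  obtain ⟨⟨d, b⟩, z⟩ := a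
  dsimp only at hside h1
  -- Only the sides opposite to `v₀` and `v₂` can be crossed, so the walk stays over one edge of
  -- `P`, which has four chambers. This sign is unchanged under `nbr 0` and reversed under `nbr 2`;
  -- it compensates the sign that the component along side `0` picks up at side `2`.
  let χ : P.Chamber → ℤ := fun C => if (C.1 = d ↔ C.2 = b) then 1 else -1
  have hχ : χ (d, b) = 1 := by simp [χ]
  have hd : d.symm ≠ d := SimpleGraph.Dart.symm_ne d
  have hnbr : ∀ {C D : P.Chamber}, (C.1 = d ∨ C.1 = d.symm) →
      (P.chamberAdj 0 C D → (D.1 = d ∨ D.1 = d.symm) ∧ χ D = χ C) ∧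
      (P.chamberAdj 2 C D → (D.1 = d ∨ D.1 = d.symm) ∧ χ D = -χ C) := by
    rintro ⟨e, b'⟩ D (rfl | rfl) <;> constructor <;> rintro rfl <;>
    cases b <;> cases b' <;> simp [RotationMap.nbr, χ, hd, hd.symm]
  have key := FaceChain.eq_zero
    (I := fun c : P.Chamber × Chamber l m => c.2.1 2 = z.1 2 ∧ (c.1.1 = d ∨ c.1.1 = d.symm))
    (f := fun c => χ c.1 * tangentU 0 c.2) (g := fun c => χ c.1 * tangentW 0 c.2) ?_ ?_ hs hs'
    ⟨rfl, Or.inl rfl⟩ hc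
  · simp only [hχ, one_mul] at key
    exact tangent_nondegenerate 0 z key
  · rintro ⟨C, x⟩ ⟨D, y⟩ ⟨hx, hC⟩ (⟨rfl, h⟩ | ⟨k, h, hk, rfl⟩)
    · obtain ⟨e1, e2⟩ := tangent_innerAdj_zero 0 h
      exact ⟨⟨(h.2 2 (by decide)).symm.trans hx, hC⟩, by simp only [e1], by simp only [e2]⟩
    · rcases hside (by decide) hx h with rfl | rfl
      · obtain ⟨e1, e2⟩ := (hnbr hC).1 hk
        have e3 := tangent_onSide_zero hl hlm 0 h
        dsimp only at e3 e2 ⊢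
        exact ⟨⟨hx, e1⟩, by rw [e2, e3], by rw [e2, e3]⟩
      · obtain ⟨e1, e2⟩ := (hnbr hC).2 hk
        have e3 := tangent_onSide_zero_two hl hlm h
        dsimp only at e3 e2 ⊢
        exact ⟨⟨hx, e1⟩, by rw [e2, e3]; ring, by rw [e2, e3]; ring⟩
  · rintro ⟨C, x⟩ ⟨D, y⟩ ⟨hx, hC⟩ (⟨rfl, h⟩ | ⟨k, h, hk, rfl⟩)
    · obtain ⟨e1, e2⟩ := tangent_innerAdj_one 0 h
      exact ⟨⟨(h.2 2 (by decide)).symm.trans hx, hC⟩, by simp only [e1], by simp only [e2]; ring⟩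
    · rcases hside (by decide) hx h with rfl | rfl
      · obtain ⟨e1, e2⟩ := (hnbr hC).1 hk
        have e3 := tangent_onSide_one hl hlm 0 h
        dsimp only at e3 e2 ⊢
        exact ⟨⟨hx, e1⟩, by rw [e2], by rw [e2, e3]; ring⟩
      · obtain ⟨e1, e2⟩ := (hnbr hC).2 hk
        have e3 := tangent_onSide_one_two hl hlm h
        dsimp only at e3 e2 ⊢
        exact ⟨⟨hx, e1⟩, by rw [e2, e3]; ring, by rw [e2, e3]; ring⟩

/-- The colour of the edges of chambers at the corner `v₀` that lie on a side of the triangle. -/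
def cornerColour (m : ℕ) : Fin 3 := if m = 0 then 1 else 0

/-- The angle at `v₀` is 60 degrees, so two chambers meet there, one along each side. -/
theorem corner_onSide (hl : 0 < l) (hlm : l = m ∨ m = 0) {x : Chamber l m}
    (h1 : sideForm l m 1 (x.1 2) = 0) (h2 : sideForm l m 2 (x.1 2) = 0) :
    OnSide (cornerColour m) 1 x ∨ OnSide (cornerColour m) 2 x := by
  have f := x.sideForm_nonneg hl hlm
  unfold OnSide
  simp only [bary_eq_zero_iff hl hlm]
  obtain ⟨a, t, u₁, u₂, w₁, w₂, hu, e1, e2, e3, e4, e5, e6⟩ := x.2.1.exists_normalForm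
  by_cases hm : m = 0 <;>
  simp [Fin.forall_fin_succ, sideForm, cornerColour, hm, e1, e2, e3, e4, e5, e6]
    at f h1 h2 ⊢ <;>
  rcases hu with hu | hu | hu | hu | hu | hu | hu | hu | hu | hu | hu | hu <;> omega

theorem corner_not_onSide (hl : 0 < l) (hlm : l = m ∨ m = 0) {x : Chamber l m}
    (h1 : sideForm l m 1 (x.1 2) = 0) (h2 : sideForm l m 2 (x.1 2) = 0) {i : Fin 3} (hi : i ≠ 2)
    (hi' : i ≠ cornerColour m) (k : Fin 3) : ¬ OnSide i k x := by
  intro h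
  have g2 := h.sideForm_eq_zero hl hlm (j := 2) hi.symm
  have g0 := h.sideForm_eq_zero hl hlm (j := 0)
  have g1 := h.sideForm_eq_zero hl hlm (j := 1)
  clear h
  obtain ⟨a, t, u₁, u₂, w₁, w₂, hu, e1, e2, e3, e4, e5, e6⟩ := x.2.1.exists_normalForm
  have f := x.sideForm_nonneg hl hlm
  by_cases hm : m = 0 <;> fin_cases i <;> simp [cornerColour, hm] at hi hi' g0 g1 <;>
  fin_cases k <;>
  simp [Fin.forall_fin_succ, sideForm, hm, e1, e2, e3, e4, e5, e6] at f h1 h2 g0 g1 g2 <;>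
  rcases hu with hu | hu | hu | hu | hu | hu | hu | hu | hu | hu | hu | hu <;> omega

theorem corner_innerAdj (hl : 0 < l) (hlm : l = m ∨ m = 0) {x y : Chamber l m}
    (h1 : sideForm l m 1 (x.1 2) = 0) (h2 : sideForm l m 2 (x.1 2) = 0) {i : Fin 3} (hi : i ≠ 2)
    (h : InnerAdj i x y) :
    OnSide (cornerColour m) 1 x ↔ ¬ OnSide (cornerColour m) 1 y := by
  have hy1 : sideForm l m 1 (y.1 2) = 0 := by rw [← h.2 2 hi.symm, h1]
  have hy2 : sideForm l m 2 (y.1 2) = 0 := by rw [← h.2 2 hi.symm, h2]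
  have hic : i ≠ cornerColour m := by
    rintro rfl
    rcases corner_onSide hl hlm h1 h2 with h' | h'
    · exact h.not_onSide hl hlm h'
    · exact h.not_onSide hl hlm h'
  have f := x.sideForm_nonneg hl hlm
  have f' := y.sideForm_nonneg hl hlm
  have ho := h.eq_opposite
  have y0 := fun hj => (h.2 0 hj).symm
  have y1 := fun hj => (h.2 1 hj).symm
  have y2 := (h.2 2 hi.symm).symm
  clear h
  unfold OnSide
  simp only [bary_eq_zero_iff hl hlm]
  obtain ⟨a, t, u₁, u₂, w₁, w₂, hu, e1, e2, e3, e4, e5, e6⟩ := x.2.1.exists_normalForm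
  have o1 : opposite x.1 1 = (2 * a + 2 * u₁ - w₁, 2 * a + 6 * t + 2 * u₂ - w₂) := by
    simp only [opposite, Prod.ext_iff]; omega
  have o0 : opposite x.1 0 = (2 * a + 2 * w₁, 2 * a + 6 * t + 2 * w₂) := by
    simp only [opposite, Prod.ext_iff]; omega
  by_cases hm : m = 0 <;> fin_cases i <;> simp [cornerColour, hm] at hi hic y0 y1 ho <;>
  simp [Fin.forall_fin_succ, sideForm, cornerColour, hm, y0, y1, y2, ho, o0, o1, e1, e2, e3,
    e4, e5, e6] at f f' h1 h2 hy1 hy2 ⊢ <;>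
  rcases hu with hu | hu | hu | hu | hu | hu | hu | hu | hu | hu | hu | hu <;> omega

end GC

/-! ### Vertex degrees and the faces that replace vertices -/

namespace RotationMap

variable {V : Type} (P : RotationMap V)

theorem nbr_nbr (i : Fin 3) (C : P.Chamber) : P.nbr i (P.nbr i C) = C := by
  obtain ⟨d, b⟩ := C
  fin_cases i <;> cases b <;> simp [nbr]

/-- Every vertex has degree at least three. -/
def MinDegreeThree : Prop := ∀ d, P.rot d ≠ d ∧ P.rot (P.rot d) ≠ d

variable {P}

/-- The composite of the two moves is `rot` or its inverse on darts, depending on the orientation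
flag. -/
theorem MinDegreeThree.nbr_two_one_ne (h : P.MinDegreeThree) (C : P.Chamber) :
    P.nbr 2 (P.nbr 1 C) ≠ C ∧ P.nbr 2 (P.nbr 1 (P.nbr 2 (P.nbr 1 C))) ≠ C := by
  obtain ⟨d, b⟩ := C
  cases b
  · simp only [nbr, ne_eq, Prod.mk.injEq, Bool.not_true, and_true, Equiv.symm_apply_eq]
    exact ⟨(h d).1.symm, (h d).2.symm⟩
  · simp only [nbr, ne_eq, Prod.mk.injEq, Bool.not_false, and_true]
    exact h d

theorem MinDegreeThree.nbr_one_two_ne (h : P.MinDegreeThree) (C : P.Chamber) :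
    P.nbr 1 (P.nbr 2 C) ≠ C ∧ P.nbr 1 (P.nbr 2 (P.nbr 1 (P.nbr 2 C))) ≠ C := by
  have key := h.nbr_two_one_ne (P.nbr 2 C)
  constructor
  · intro e
    exact key.1 (congrArg (P.nbr 2) e)
  · intro e
    exact key.2 (congrArg (P.nbr 2) e)

end RotationMap

namespace GC

open HexTiling

variable {l m : ℕ} {V : Type} {P : RotationMap V}

open Classical in
/-- The face that replaces a vertex has size at least six. -/
theorem not_faceChain_of_corner (hl : 0 < l) (hlm : l = m ∨ m = 0) (hP : P.MinDegreeThree)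
    {a : P.Chamber × Chamber l m} (h1 : sideForm l m 1 (a.2.1 2) = 0)
    (h2 : sideForm l m 2 (a.2.1 2) = 0) {s : ℕ} (hs : 0 < s) (hs' : s ≤ 5) :
    ¬ FaceChain (resultAdj l m P) s a a := by
  intro hc
  -- The side of the triangle crossed in one chain step. For `m = 0` the inner move comes first, so
  -- it is the side touched by the other of the two chambers at `v₀`; otherwise the crossing comes
  -- first.
  let κ : Bool → Fin 3 := fun t => if (t = true ↔ m = 0) then 2 else 1
  let I : P.Chamber × Chamber l m → Prop := fun b =>
    sideForm l m 1 (b.2.1 2) = 0 ∧ sideForm l m 2 (b.2.1 2) = 0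
  let f : P.Chamber × Chamber l m → P.Chamber × Bool := fun b =>
    (b.1, decide (OnSide (cornerColour m) 1 b.2))
  have hinner : ∀ i, i ≠ 2 → i ≠ cornerColour m → ∀ b c, I b → resultAdj l m P i b c →
      I c ∧ f c = ((f b).1, !(f b).2) := by
    rintro i hi hi' ⟨C, x⟩ ⟨D, y⟩ ⟨hb1, hb2⟩ (⟨h, h'⟩ | ⟨k, h, -, -⟩)
    · dsimp only at hb1 hb2 h h'
      refine ⟨⟨by rw [← h'.2 2 hi.symm]; exact hb1, by rw [← h'.2 2 hi.symm]; exact hb2⟩, ?_⟩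
      have := corner_innerAdj hl hlm hb1 hb2 hi h'
      simp [f, h, this]
    · exact absurd h (corner_not_onSide hl hlm hb1 hb2 hi hi' k)
  have hside : ∀ b c, I b → resultAdj l m P (cornerColour m) b c →
      I c ∧ f c = (P.nbr (if (f b).2 then 1 else 2) (f b).1, (f b).2) := by
    rintro ⟨C, x⟩ ⟨D, y⟩ ⟨hb1, hb2⟩ (⟨h, h'⟩ | ⟨k, h, hk, rfl⟩)
    · rcases corner_onSide hl hlm hb1 hb2 with ho | ho
      · exact absurd ho (h'.not_onSide hl hlm)
      · exact absurd ho (h'.not_onSide hl hlm)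
    · refine ⟨⟨hb1, hb2⟩, ?_⟩
      dsimp only at h hk
      by_cases h1 : OnSide (cornerColour m) 1 x
      · obtain rfl := h.unique hl hlm h1
        simp only [f, h1, decide_true, if_true]
        rw [← hk]
      · have ho := (corner_onSide hl hlm hb1 hb2).resolve_left h1
        obtain rfl := h.unique hl hlm ho
        simp only [f, h1, decide_false, Bool.false_eq_true, if_false]
        rw [← hk]
  have key := hc.iterate_eq (I := I) (f := f) (g := fun p => (P.nbr (κ p.2) p.1, !p.2))
    (fun b c e hb hbc hce => by
      by_cases hm : m = 0
      · obtain ⟨hc, e1⟩ := hinner 0 (by decide) (by simp [cornerColour, hm]) b c hb hbc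
        obtain ⟨he, e2⟩ := hside c e hc (by simpa [cornerColour, hm] using hce)
        refine ⟨he, ?_⟩
        rw [e2, e1]
        cases (f b).2 <;> simp [κ, hm]
      · obtain ⟨hc, e1⟩ := hside b c hb (by simpa [cornerColour, hm] using hbc)
        obtain ⟨he, e2⟩ := hinner 1 (by decide) (by simp [cornerColour, hm]) c e hc hce
        refine ⟨he, ?_⟩
        rw [e2, e1]
        cases (f b).2 <;> simp [κ, hm]) ⟨h1, h2⟩
  generalize f a = q at key
  obtain ⟨C, t⟩ := q
  have g1 := hP.nbr_one_two_ne C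
  have g2 := hP.nbr_two_one_ne C
  -- An odd number of steps ends in the other chamber at `v₀`. Two or four steps would make `rot` or
  -- its square fix a dart.
  by_cases hm : m = 0 <;> interval_cases s <;> cases t <;> simp [κ, hm] at key <;>
  first | exact g1.1 key.symm | exact g2.1 key.symm | exact g1.2 key.symm | exact g2.2 key.symm

/-- Only the faces of the original map can have size less than six. -/
theorem FaceChain.eq_baseChamber (hl : 0 < l) (hlm : l = m ∨ m = 0) (hP : P.MinDegreeThree)
    {a : P.Chamber × Chamber l m} {s : ℕ} (hs : 0 < s) (hs' : s ≤ 5)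
    (h : FaceChain (resultAdj l m P) s a a) : a.2 = baseChamber hl hlm := by
  by_cases h1 : sideForm l m 1 (a.2.1 2) = 0
  · by_cases h2 : sideForm l m 2 (a.2.1 2) = 0
    · exact absurd h (not_faceChain_of_corner hl hlm hP h1 h2 hs hs')
    · by_cases h0 : sideForm l m 0 (a.2.1 2) = 0
      · apply GC.eq_baseChamber
        apply eq_of_sideForm_eq_zero (k := 0) (k' := 1) (by decide) h0 h1
        · simp [sideForm]
        · simp [sideForm]
      · exact absurd h (not_faceChain_of_side_one hl hlm h0 h2 hs hs')
  · exact absurd h (not_faceChain_of_not_side_one hl hlm h1 hs hs')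

/-- A small face of the original map is a small face of the result. -/
theorem faceChain_baseChamber (hl : 0 < l) (hlm : l = m ∨ m = 0) {d : P.graph.Dart} {s : ℕ}
    (h : (P.facePerm ^ s) d = d) :
    FaceChain (resultAdj l m P) s ((d, true), baseChamber hl hlm)
      ((d, true), baseChamber hl hlm) := by
  have hadj : ∀ (i k : Fin 3), (∀ j, j ≠ i → sideForm l m k (baseTriple m j) = 0) →
      ∀ C : P.Chamber, resultAdj l m P i (C, baseChamber hl hlm)
        (P.nbr k C, baseChamber hl hlm) := fun i k hik C =>
    Or.inr ⟨k, fun j hj => (bary_eq_zero_iff hl hlm _ _).2 (hik j hj), rfl, rfl⟩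
  by_cases hm : m = 0
  · have key : ∀ (n : ℕ) (e : P.graph.Dart), FaceChain (resultAdj l m P) n
        ((e, true), baseChamber hl hlm) (((P.facePerm ^ n) e, true), baseChamber hl hlm) := by
      intro n
      induction n with
      | zero => intro e; rfl
      | succ n ih =>
        intro e
        refine ⟨_, _, hadj 0 0 ?_ _, hadj 1 1 ?_ _, ih (P.facePerm e)⟩ <;>
        intro j hj <;> fin_cases j <;> simp [sideForm, baseTriple, hm] at hj ⊢
    simpa [h] using key s d
  -- For `m = l` the vertex of the base chamber lies on the side `v₁ v₂` instead of `v₀ v₂`; the two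
  -- crossings change roles and the chain runs backwards around the face.
  · have key : ∀ (n : ℕ) (e : P.graph.Dart), FaceChain (resultAdj l m P) n
        ((e, true), baseChamber hl hlm) (((P.facePerm⁻¹ ^ n) e, true), baseChamber hl hlm) := by
      intro n
      induction n with
      | zero => intro e; rfl
      | succ n ih =>
        intro e
        refine ⟨_, _, hadj 0 1 ?_ _, hadj 1 0 ?_ _, ih (P.facePerm⁻¹ e)⟩ <;>
        intro j hj <;> fin_cases j <;> simp [sideForm, baseTriple, hm] at hj ⊢
    have h' : (P.facePerm⁻¹ ^ s) d = d := by
      rw [inv_pow, Equiv.Perm.inv_eq_iff_eq, h]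
    have := key s d
    rwa [h'] at this

end GC

/-! ### Connectivity and Euler's formula -/

namespace RotationMap

variable {V : Type} {P : RotationMap V}

theorem rot_sameCycle_induction {p : P.graph.Dart → Prop} (hp : ∀ d, p (P.rot d) ↔ p d)
    {d e : P.graph.Dart} (h : P.rot.SameCycle d e) (hd : p d) : p e := by
  obtain ⟨i, rfl⟩ := h
  induction i with
  | zero => exact hd
  | succ i ih => rw [add_comm, zpow_add]; exact (hp _).2 ih
  | pred i ih =>
    rw [← hp, ← Equiv.Perm.mul_apply, mul_self_zpow, sub_add_cancel]
    exact ih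

theorem exists_adj_of_connected {S : Set V} (h : (P.graph.induce Sᶜ).Connected) {v w : V}
    (hv : v ∉ S) (hw : w ∉ S) (hvw : v ≠ w) : ∃ u, u ∉ S ∧ P.graph.Adj v u := by
  obtain ⟨p⟩ := h.preconnected ⟨v, hv⟩ ⟨w, hw⟩
  cases p with
  | nil => exact absurd rfl hvw
  | @cons _ u _ h _ => exact ⟨u, u.2, h⟩

theorem exists_notMem_ne [Finite V] (h4 : 4 ≤ Nat.card V) {S : Set V} (hS : S.ncard ≤ 2) (v : V) :
    ∃ w, w ∉ S ∧ v ≠ w := by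
  by_contra! h
  have : (Set.univ : Set V) ⊆ insert v S := fun w _ => by
    by_cases hw : w ∈ S
    · exact Or.inr hw
    · exact Or.inl (h w hw).symm
  have h1 := Set.ncard_le_ncard this (Set.toFinite _)
  have h2 := Set.ncard_insert_le v S
  rw [Set.ncard_univ] at h1
  omega

theorem exists_dart_of_threeConnected [Finite V] (h : IsThreeConnected P.graph) (v : V) :
    ∃ d : P.graph.Dart, d.fst = v := by
  obtain ⟨w, -, hw⟩ := exists_notMem_ne h.1 (S := ∅) (by simp) v
  obtain ⟨u, -, hu⟩ := exists_adj_of_connected (h.2 ∅ (by simp)) (by simp) (by simp) hw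
  exact ⟨⟨(v, u), hu⟩, rfl⟩

/-- Otherwise deleting the at most two neighbours of a vertex would isolate it. -/
theorem minDegreeThree_of_threeConnected [Finite V] (h : IsThreeConnected P.graph) :
    P.MinDegreeThree := by
  have key : ∀ d, P.rot (P.rot d) ≠ d := by
    intro d hd
    set S : Set V := {d.snd, (P.rot d).snd} with hS
    have hc : S.ncard ≤ 2 := by
      have := Set.ncard_insert_le d.snd {(P.rot d).snd}
      rwa [Set.ncard_singleton] at this
    have hv : d.fst ∉ S := by
      rintro (h | h)
      · exact d.adj.ne h
      · rw [← P.rot_fst] at h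
        exact (P.rot d).adj.ne h
    obtain ⟨w, hw, hvw⟩ := exists_notMem_ne h.1 hc d.fst
    obtain ⟨u, hu, ha⟩ := exists_adj_of_connected (h.2 S hc) hv hw hvw
    have := rot_sameCycle_induction (p := fun e => e = d ∨ e = P.rot d) (fun e => by
      constructor
      · rintro (h | h)
        · rw [← hd] at h
          exact Or.inr (P.rot.injective h)
        · exact Or.inl (P.rot.injective h)
      · rintro (rfl | rfl)
        · exact Or.inr rfl
        · exact Or.inl hd) (P.rot_cyclic d ⟨(d.fst, u), ha⟩ rfl) (Or.inl rfl)
    rcases this with h | h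
    · exact hu (Or.inl (by rw [← h]))
    · exact hu (Or.inr (by rw [← h]; rfl))
  exact fun d => ⟨fun h => key d (by rw [h, h]), key d⟩

/-- The barycentric subdivision of a connected map is connected. -/
theorem forall_of_nbr (h : P.graph.Connected) {p : P.Chamber → Prop}
    (hp : ∀ i C, p C → p (P.nbr i C)) {C : P.Chamber} (hC : p C) (D : P.Chamber) : p D := by
  have hp' : ∀ i C, p (P.nbr i C) ↔ p C := fun i C =>
    ⟨fun h => P.nbr_nbr i C ▸ hp i _ h, hp i C⟩
  have h2 : ∀ d b, p (d, b) ↔ p (d, true) := by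
    intro d b
    cases b
    · exact hp' 2 (d, true)
    · rfl
  have h1 : ∀ d, p (P.rot d, true) ↔ p (d, true) := fun d => by
    rw [← h2 _ false]; exact hp' 1 (d, true)
  have h0 : ∀ d, p (d.symm, true) ↔ p (d, true) := fun d => by
    rw [← h2 _ false]; exact hp' 0 (d, true)
  have hq : ∀ {d e : P.graph.Dart}, d.fst = e.fst → p (d, true) → p (e, true) :=
    fun he hd => rot_sameCycle_induction (p := fun d => p (d, true)) h1 (P.rot_cyclic _ _ he) hd
  obtain ⟨d, b⟩ := C
  obtain ⟨e, b'⟩ := D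
  rw [h2] at hC ⊢
  obtain ⟨w⟩ := h.preconnected d.fst e.fst
  have key : ∀ {u v : V} (_ : P.graph.Walk u v) (d e : P.graph.Dart), d.fst = u → e.fst = v →
      p (d, true) → p (e, true) := by
    intro u v w
    induction w with
    | nil => exact fun d e hd he => hq (hd.trans he.symm)
    | cons ha _ ih =>
      intro d e hd he hpd
      refine ih (SimpleGraph.Dart.symm ⟨(_, _), ha⟩) e rfl he ((h0 _).2 (hq ?_ hpd))
      exact hd
  exact key w d e rfl rfl hC

theorem leftFace_surjective (P : RotationMap V) : Function.Surjective P.leftFace :=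
  fun f => Quotient.exists_rep f

instance [Finite V] : Finite P.graph.Dart :=
  Finite.of_injective (fun d => d.toProd) fun _ _ h => SimpleGraph.Dart.ext _ _ h

/-- A map on the sphere with minimum degree at least three has a face of size at most five. -/
theorem exists_small_face [Finite V] (h : IsThreeConnected P.graph) (hg : P.HasGenus 0) :
    ∃ (d : P.graph.Dart) (s : ℕ), 0 < s ∧ s ≤ 5 ∧ (P.facePerm ^ s) d = d := by
  classical
  by_contra! hcon
  have hdeg := minDegreeThree_of_threeConnected h
  have hE : Nat.card P.graph.Dart = 2 * Nat.card P.graph.edgeSet := by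
    have := Fintype.ofFinite V
    rw [Nat.card_eq_fintype_card, SimpleGraph.dart_card_eq_twice_card_edges,
      Nat.card_eq_fintype_card, SimpleGraph.card_edgeSet]
  have hV : 3 * Nat.card V ≤ Nat.card P.graph.Dart := by
    choose f hf using exists_dart_of_threeConnected h
    have hfst : ∀ (n : ℕ) d, ((P.rot ^ n) d).fst = d.fst := by
      intro n
      induction n with
      | zero => intro d; rfl
      | succ n ih => intro d; rw [pow_succ, Equiv.Perm.mul_apply, ih, P.rot_fst]
    have := Nat.card_le_card_of_injective (fun x : V × Fin 3 => (P.rot ^ (x.2 : ℕ)) (f x.1)) (by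
      rintro ⟨v, i⟩ ⟨w, j⟩ he
      have hv : v = w := by
        have := congrArg (fun e => e.fst) he
        simpa [hfst, hf] using this
      subst hv
      have h1 := hdeg (f v)
      have h2 := hdeg (P.rot (f v))
      fin_cases i <;> fin_cases j <;> simp [pow_succ] at he ⊢ <;> grind)
    simpa [Nat.card_prod, mul_comm] using this
  have hF : 6 * Nat.card P.Face ≤ Nat.card P.graph.Dart := by
    have hface : ∀ (n : ℕ) d, P.leftFace ((P.facePerm ^ n) d) = P.leftFace d := by
      intro n d
      exact Quotient.sound ((Equiv.Perm.sameCycle_pow_left).2 (Equiv.Perm.SameCycle.refl _ _))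
    choose out hout using P.leftFace_surjective
    have := Nat.card_le_card_of_injective
      (fun x : P.Face × Fin 6 => (P.facePerm ^ (x.2 : ℕ)) (out x.1)) (by
      rintro ⟨v, i⟩ ⟨w, j⟩ he
      have hv : v = w := by
        have := congrArg P.leftFace he
        simp only [hface] at this
        rwa [hout, hout] at this
      subst hv
      have key : ∀ i j : ℕ, i < j → j < 6 →
          (P.facePerm ^ i) (out v) ≠ (P.facePerm ^ j) (out v) := by
        intro i j hij hj he
        apply hcon (out v) (j - i) (by omega) (by omega)
        apply (P.facePerm ^ i).injective
        rw [← Equiv.Perm.mul_apply, ← pow_add, he, Nat.add_sub_cancel' hij.le]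
      dsimp only at he
      rcases lt_trichotomy (i : ℕ) j with hij | hij | hij
      · exact absurd he (key _ _ hij j.2)
      · rw [Fin.ext hij]
      · exact absurd he.symm (key _ _ hij i.2))
    simpa [Nat.card_prod, mul_comm] using this
  -- Now `3 V ≤ 2 E` and `6 F ≤ 2 E`, so the Euler characteristic would be at most zero.
  unfold HasGenus at hg
  push_cast at hg
  omega

end RotationMap

/-! ### No new symmetry in genus 0 -/

namespace GC

variable {l m : ℕ} {V : Type} {P : RotationMap V}

theorem resultAdj.of_onSide {i k : Fin 3} {x : Chamber l m} (h : OnSide i k x) (C : P.Chamber) :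
    resultAdj l m P i (C, x) (P.nbr k C, x) := Or.inr ⟨k, h, rfl, rfl⟩

theorem resultAdj.of_innerAdj {i : Fin 3} {x y : Chamber l m} (h : InnerAdj i x y)
    (C : P.Chamber) : resultAdj l m P i (C, x) (C, y) := Or.inl ⟨rfl, h⟩

theorem chamberAdj_of_resultAdj (hl : 0 < l) (hlm : l = m ∨ m = 0) {i k : Fin 3}
    {x : Chamber l m} (h : OnSide i k x) {C D : P.Chamber}
    (hr : resultAdj l m P i (C, x) (D, x)) : P.chamberAdj k C D := by
  rcases hr with ⟨-, h'⟩ | ⟨k', h', ha, -⟩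
  · exact absurd rfl h'.1
  · exact h.unique hl hlm h' ▸ ha

theorem not_increasesSymmetry [Finite V] (hl : 0 < l) (hlm : l = m ∨ m = 0)
    (h3 : m = 0 → 3 ∣ l) (hP : RotationMap.IsThreeConnected P.graph) (hg : P.HasGenus 0) :
    ¬ IncreasesSymmetry l m P := by
  have hdeg := RotationMap.minDegreeThree_of_threeConnected hP
  have hconn : P.graph.Connected := by
    have := hP.2 ∅ (by simp)
    rw [Set.compl_empty] at this
    exact (SimpleGraph.Iso.connected_iff (SimpleGraph.induceUnivIso P.graph)).1 this
  obtain ⟨d₀, s, hs, hs', hd₀⟩ := RotationMap.exists_small_face hP hg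
  have hadj : ∀ σ ∈ chamberAut (resultAdj l m P), ∀ i x y, resultAdj l m P i x y →
      resultAdj l m P i (σ x) (σ y) := fun σ hσ i x y => (hσ i x y).2
  -- It suffices that one chamber keeps its position in the triangle: uniqueness of neighbours
  -- spreads this over its copy, and then across the sides to all copies. The start is a chamber at
  -- the centre of a small face.
  have key : ∀ σ ∈ chamberAut (resultAdj l m P), ∀ C : P.Chamber, ∃ C', ∀ x, σ (C, x) = (C', x) := by
    intro σ hσ
    have hinner : ∀ C C' x, σ (C, x) = (C', x) → ∀ y, σ (C, y) = (C', y) := by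
      intro C C' x hx
      refine forall_of_innerAdj hl hlm ?_ hx
      intro i x y hxy hx
      have h1 := hadj σ hσ i _ _ (resultAdj.of_innerAdj (P := P) hxy C)
      rw [hx] at h1
      exact h1.unique hl hlm (resultAdj.of_innerAdj hxy C')
    refine RotationMap.forall_of_nbr hconn (p := fun C => ∃ C', ∀ x, σ (C, x) = (C', x))
      ?_ (C := (d₀, true)) ?_
    · rintro k C ⟨C', hC⟩
      obtain ⟨i, x, hx⟩ := exists_onSide hl hlm h3 k
      refine ⟨P.nbr k C', hinner _ _ x ?_⟩
      have h1 := hadj σ hσ i _ _ (resultAdj.of_onSide hx C)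
      rw [hC] at h1
      exact h1.unique hl hlm (resultAdj.of_onSide hx C')
    · have h1 := ((faceChain_baseChamber (P := P) hl hlm hd₀).map (hadj σ hσ)).eq_baseChamber
        hl hlm hdeg hs hs'
      exact ⟨(σ ((d₀, true), baseChamber hl hlm)).1, hinner _ _ _ (Prod.ext rfl h1)⟩
  choose! τ hτ using key
  have hinv : ∀ σ ∈ chamberAut (resultAdj l m P), ∀ C, τ σ⁻¹ (τ σ C) = C := by
    intro σ hσ C
    have h1 := hτ σ hσ C (baseChamber hl hlm)
    have h2 := hτ σ⁻¹ (inv_mem hσ) (τ σ C) (baseChamber hl hlm)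
    rw [← h1, Equiv.Perm.inv_def, Equiv.symm_apply_apply] at h2
    exact (congrArg Prod.fst h2).symm
  let F : chamberAut (resultAdj l m P) → chamberAut P.chamberAdj := fun σ =>
    ⟨⟨τ σ, τ σ.1⁻¹, hinv _ σ.2, fun C => by
      have := hinv _ (inv_mem σ.2) C
      rwa [inv_inv] at this⟩, by
      intro k C D
      obtain ⟨i, x, hx⟩ := exists_onSide hl hlm h3 k
      have h1 := σ.2 i (C, x) (D, x)
      rw [hτ σ σ.2, hτ σ σ.2] at h1
      constructor
      · intro h
        refine chamberAdj_of_resultAdj hl hlm hx (h1.1 ?_)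
        exact Or.inr ⟨k, hx, h, rfl⟩
      · intro h
        refine chamberAdj_of_resultAdj hl hlm hx (h1.2 ?_)
        exact Or.inr ⟨k, hx, h, rfl⟩⟩
  have hF : Function.Injective F := by
    intro σ σ' h
    apply Subtype.ext
    apply Equiv.ext
    rintro ⟨C, x⟩
    have h1 : τ σ C = τ σ' C := congrArg (fun f => f.1 C) h
    rw [hτ σ σ.2, hτ σ' σ'.2, h1]
  exact not_lt.2 (Nat.card_le_card_of_injective F hF)

end GC

/-! ### The equilateral triangle and its symmetries -/

namespace GC

open HexTiling

variable {l m : ℕ}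

/-- The reflection in the side opposite to `v₀`. -/
def mirror (m : ℕ) (p : ℤ × ℤ) : ℤ × ℤ := if m = 0 then (p.2, p.1) else (-p.1, p.1 + p.2)

/-- The rotation by 120 degrees about the centre of the equilateral triangle that consists of the
triangle `v₀ v₁ v₂` and its image under `mirror`. -/
def turn (l m : ℕ) (p : ℤ × ℤ) : ℤ × ℤ := (-p.1 - p.2 + 2 * l, p.1 + 2 * m)

/-- The linear forms that define the sides of the equilateral triangle. -/
def doubleForm (l m : ℕ) : Fin 3 → ℤ × ℤ → ℤ
  | 0, p => sideForm l m 2 p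
  | 1, p => sideForm l m 1 (mirror m p)
  | 2, p => sideForm l m 1 p

theorem mirror_mirror (p : ℤ × ℤ) : mirror m (mirror m p) = p := by
  by_cases hm : m = 0 <;> simp [mirror, hm]

theorem turn_turn_turn (p : ℤ × ℤ) : turn l m (turn l m (turn l m p)) = p := by
  simp only [turn, Prod.ext_iff]; omega

theorem mirror_turn (hlm : l = m ∨ m = 0) (p : ℤ × ℤ) :
    mirror m (turn l m p) = turn l m (turn l m (mirror m p)) := by
  by_cases hm : m = 0 <;> simp [mirror, turn, hm, Prod.ext_iff] <;> omega

theorem doubleForm_turn (hlm : l = m ∨ m = 0) (k : Fin 3) (p : ℤ × ℤ) :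
    doubleForm l m (k + 1) (turn l m p) = doubleForm l m k p := by
  by_cases hm : m = 0 <;> fin_cases k <;> simp [doubleForm, mirror, turn, sideForm, hm] <;> omega

theorem sideForm_zero_mirror (p : ℤ × ℤ) :
    sideForm l m 0 (mirror m p) = -sideForm l m 0 p := by
  by_cases hm : m = 0 <;> simp [mirror, sideForm, hm]

theorem sideForm_two_mirror (p : ℤ × ℤ) : sideForm l m 2 (mirror m p) = sideForm l m 2 p := by
  by_cases hm : m = 0 <;> simp [mirror, sideForm, hm] <;> omega

theorem sideForm_one_mirror_nonneg {p : ℤ × ℤ} (h : ∀ k, 0 ≤ sideForm l m k p) :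
    0 ≤ sideForm l m 1 (mirror m p) := by
  have h0 := h 0
  have h1 := h 1
  by_cases hm : m = 0 <;> simp [mirror, sideForm, hm] at h0 h1 ⊢ <;> omega

theorem eq_zero_of_sideForm_one_mirror {p : ℤ × ℤ} (h : ∀ k, 0 ≤ sideForm l m k p)
    (hp : sideForm l m 1 (mirror m p) = 0) : p = (0, 0) := by
  have h0 := h 0
  have h1 := h 1
  apply Prod.ext_iff.2
  by_cases hm : m = 0 <;> simp [mirror, sideForm, hm] at h0 h1 hp ⊢ <;> omega

theorem mirror_eq_self {p : ℤ × ℤ} (h : sideForm l m 0 p = 0) : mirror m p = p := by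
  by_cases hm : m = 0 <;> simp [mirror, sideForm, hm, Prod.ext_iff] at h ⊢ <;> omega

theorem isChamber_mirror {c : Fin 3 → ℤ × ℤ} (hc : IsChamber c) :
    IsChamber fun i => mirror m (c i) := by
  refine ⟨fun i => ?_, ?_⟩
  · have := hc.1 i
    by_cases hm : m = 0 <;> fin_cases i <;>
    simp only [HasColour, mirror, hm, if_true, if_false, Int.even_iff, Fin.mk_zero, Fin.mk_one,
      Fin.reduceFinMk] at this ⊢ <;> omega
  · obtain ⟨-, h1, h2, h3⟩ := hc
    by_cases hm : m = 0 <;> simp only [sqDist, mirror, hm, if_true, if_false] at h1 h2 h3 ⊢ <;>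
    exact ⟨by linear_combination h1, by linear_combination h2, by linear_combination h3⟩

/-- This is where the colour of `v₀` matters: the rotation takes `v₂` to `v₀`, so it respects the
colours because `3 ∣ l - m`. -/
theorem isChamber_turn (hlm : l = m ∨ m = 0) (h3 : m = 0 → 3 ∣ l) {c : Fin 3 → ℤ × ℤ}
    (hc : IsChamber c) : IsChamber fun i => turn l m (c i) := by
  refine ⟨fun i => ?_, ?_⟩
  · have := hc.1 i
    have h : (3 : ℤ) ∣ l - m := by
      rcases hlm with rfl | rfl
      · simp
      · have := h3 rfl
        omega
    fin_cases i <;>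
    simp only [HasColour, turn, Int.even_iff, Fin.mk_zero, Fin.mk_one,
      Fin.reduceFinMk] at this ⊢ <;> omega
  · obtain ⟨-, h1, h2, h3⟩ := hc
    simp only [sqDist, turn] at h1 h2 h3 ⊢
    exact ⟨by linear_combination h1, by linear_combination h2, by linear_combination h3⟩

/-- The axis through `v₁` and `v₂` is a mirror line of the tiling, so no chamber straddles it. -/
theorem sideForm_zero_dichotomy {c : Fin 3 → ℤ × ℤ} (hc : IsChamber c) :
    (∀ i, 0 ≤ sideForm l m 0 (c i)) ∨ ∀ i, 0 ≤ sideForm l m 0 (mirror m (c i)) := by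
  simp only [sideForm_zero_mirror]
  obtain ⟨a, t, u₁, u₂, w₁, w₂, hu, h1, h2, h3, h4, h5, h6⟩ := hc.exists_normalForm
  by_cases hm : m = 0 <;>
  simp [Fin.forall_fin_succ, sideForm, hm, h1, h2, h3, h4, h5, h6] <;>
  rcases hu with hu | hu | hu | hu | hu | hu | hu | hu | hu | hu | hu | hu <;> omega

/-- The chambers of the tiling that lie in the equilateral triangle. -/
def DoubleChamber (l m : ℕ) : Type :=
  {c : Fin 3 → ℤ × ℤ // IsChamber c ∧ ∀ i k, 0 ≤ doubleForm l m k (c i)}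

namespace DoubleChamber

def ofChamber (hl : 0 < l) (hlm : l = m ∨ m = 0) (x : Chamber l m) : DoubleChamber l m :=
  ⟨x.1, x.2.1, fun i k => by
    have h := x.sideForm_nonneg hl hlm i
    fin_cases k
    · exact h 2
    · exact sideForm_one_mirror_nonneg h
    · exact h 1⟩

def mirror (z : DoubleChamber l m) : DoubleChamber l m :=
  ⟨fun i => GC.mirror m (z.1 i), isChamber_mirror z.2.1, fun i k => by
    fin_cases k
    · change 0 ≤ sideForm l m 2 (GC.mirror m (z.1 i))
      rw [sideForm_two_mirror]
      exact z.2.2 i 0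
    · have := z.2.2 i 2
      simpa [doubleForm, mirror_mirror] using this
    · exact z.2.2 i 1⟩

def turn (hlm : l = m ∨ m = 0) (h3 : m = 0 → 3 ∣ l) (z : DoubleChamber l m) :
    DoubleChamber l m :=
  ⟨fun i => GC.turn l m (z.1 i), isChamber_turn hlm h3 z.2.1, fun i k => by
    have := doubleForm_turn hlm (k + 2) (z.1 i)
    rw [show k + 2 + 1 = k by rw [add_assoc]; exact add_zero k] at this
    rw [this]
    exact z.2.2 i _⟩

theorem mirror_mirror (z : DoubleChamber l m) : z.mirror.mirror = z :=
  Subtype.ext (funext fun i => GC.mirror_mirror (z.1 i))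

theorem mirror_injective : Function.Injective (mirror : DoubleChamber l m → _) :=
  Function.LeftInverse.injective mirror_mirror

variable (hlm : l = m ∨ m = 0) (h3 : m = 0 → 3 ∣ l)

theorem turn_turn_turn (z : DoubleChamber l m) :
    ((z.turn hlm h3).turn hlm h3).turn hlm h3 = z :=
  Subtype.ext (funext fun i => GC.turn_turn_turn (z.1 i))

theorem turn_injective : Function.Injective (turn hlm h3) := fun z w h => by
  rw [← turn_turn_turn hlm h3 z, h, turn_turn_turn hlm h3]

theorem mirror_turn (z : DoubleChamber l m) :
    (z.turn hlm h3).mirror = (z.mirror.turn hlm h3).turn hlm h3 :=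
  Subtype.ext (funext fun i => GC.mirror_turn hlm (z.1 i))

theorem ofChamber_injective (hl : 0 < l) : Function.Injective (ofChamber hl hlm) := fun _ _ h =>
  Subtype.ext (congrArg (fun z => z.1) h)

theorem ofChamber_ne_mirror (hl : 0 < l) (x y : Chamber l m) :
    ofChamber hl hlm x ≠ (ofChamber hl hlm y).mirror := by
  intro h
  refine sideForm_nondegenerate (l := l) (m := m) x.2.1 0 fun j => ?_
  have h1 : x.1 j = GC.mirror m (y.1 j) := congrFun (congrArg Subtype.val h) j
  have h2 := x.sideForm_nonneg hl hlm j 0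
  have h3 := y.sideForm_nonneg hl hlm j 0
  rw [h1, sideForm_zero_mirror] at h2
  rw [h1, sideForm_zero_mirror]
  omega

theorem exists_ofChamber (hl : 0 < l) (z : DoubleChamber l m) :
    (∃ x, ofChamber hl hlm x = z) ∨ ∃ x, (ofChamber hl hlm x).mirror = z := by
  have key : ∀ z : DoubleChamber l m, (∀ i, 0 ≤ sideForm l m 0 (z.1 i)) →
      ∃ x, ofChamber hl hlm x = z := fun z hz =>
    ⟨.ofSideForm hl hlm z.1 z.2.1 fun i k => by
      fin_cases k
      · exact hz i
      · exact z.2.2 i 2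
      · exact z.2.2 i 0, rfl⟩
  rcases sideForm_zero_dichotomy (l := l) (m := m) z.2.1 with h | h
  · exact Or.inl (key z h)
  · obtain ⟨x, hx⟩ := key z.mirror h
    exact Or.inr ⟨x, by rw [hx, mirror_mirror]⟩

end DoubleChamber

end GC

/-! ### Symmetries of the triangulation by vertices and faces -/

namespace RotationMap

variable {V : Type} (P : RotationMap V)

/-- The dart whose triangle (spanned by its ends and the face on its left) shares the side `k`
with the triangle of the given dart: the dart itself (`0`), the side from its head to the face
(`1`), and the side from its tail to the face (`2`). -/
def cross : Fin 3 → P.graph.Dart → P.graph.Dart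
  | 0, d => d.symm
  | 1, d => P.facePerm d
  | 2, d => P.facePerm.symm d

/-- A two-colouring of the vertices (given on darts) and an involution of the darts that describes
an automorphism of the triangulation by vertices and faces under which the faces and the vertices
of colour `false` are interchanged. -/
structure Triality where
  col : P.graph.Dart → Bool
  col_symm : ∀ d, col d.symm = !col d
  col_rot : ∀ d, col (P.rot d) = col d
  ψ : P.graph.Dart → P.graph.Dart
  ψ_ψ : ∀ d, ψ (ψ d) = d
  col_ψ : ∀ d, col (ψ d) = !col d
  ψ_cross : ∀ k d, col d = true → ψ (P.cross k d) = P.cross (k + 1) (ψ d)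

variable {P}

namespace Triality

variable (T : P.Triality)

theorem ψ_cross_succ (k : Fin 3) {d : P.graph.Dart} (hd : T.col d = false) :
    T.ψ (P.cross (k + 1) d) = P.cross k (T.ψ d) := by
  have := T.ψ_cross k (T.ψ d) (by rw [T.col_ψ, hd]; rfl)
  rw [T.ψ_ψ] at this
  rw [← this, T.ψ_ψ]

theorem col_rot_symm (d : P.graph.Dart) : T.col (P.rot.symm d) = T.col d := by
  rw [← T.col_rot, Equiv.apply_symm_apply]

theorem col_cross (k : Fin 3) (d : P.graph.Dart) : T.col (P.cross k d) = !T.col d := by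
  fin_cases k
  · exact T.col_symm d
  · exact (T.col_rot_symm d.symm).trans (T.col_symm d)
  · exact (T.col_symm _).trans (congrArg _ (T.col_rot d))

end Triality

end RotationMap

/-! ### Transfer of these symmetries to the result -/

namespace GC

open HexTiling DoubleChamber

variable {l m : ℕ} {V : Type} {P : RotationMap V}

/-- The `i`-adjacency of the result when its chambers are regarded as chambers in an equilateral
triangle at a dart. -/
def doubleAdj (P : RotationMap V) (i : Fin 3) (a b : P.graph.Dart × DoubleChamber l m) : Prop :=
  (a.1 = b.1 ∧ a.2 ≠ b.2 ∧ ∀ j, j ≠ i → a.2.1 j = b.2.1 j) ∨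
    ∃ k, (∀ j, j ≠ i → doubleForm l m k (a.2.1 j) = 0) ∧ b.1 = P.cross k a.1 ∧ b.2 = a.2.mirror

/-- A chamber of the result as a chamber in an equilateral triangle at a dart. -/
def toDouble (hl : 0 < l) (hlm : l = m ∨ m = 0) :
    P.Chamber × Chamber l m → P.graph.Dart × DoubleChamber l m
  | ((d, true), x) => (d, ofChamber hl hlm x)
  | ((d, false), x) => (d.symm, (ofChamber hl hlm x).mirror)

theorem toDouble_bijective (hl : 0 < l) (hlm : l = m ∨ m = 0) :
    Function.Bijective (toDouble hl hlm : P.Chamber × Chamber l m → _) := by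
  constructor
  · rintro ⟨⟨d, b⟩, x⟩ ⟨⟨d', b'⟩, x'⟩ h
    cases b <;> cases b' <;> simp only [toDouble, Prod.mk.injEq] at h
    · rw [ofChamber_injective hlm hl (mirror_injective h.2),
        SimpleGraph.Dart.symm_involutive.injective h.1]
    · exact absurd h.2.symm (ofChamber_ne_mirror hlm hl _ _)
    · exact absurd h.2 (ofChamber_ne_mirror hlm hl _ _)
    · rw [ofChamber_injective hlm hl h.2, h.1]
  · rintro ⟨d, z⟩
    rcases exists_ofChamber hlm hl z with ⟨x, rfl⟩ | ⟨x, rfl⟩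
    · exact ⟨((d, true), x), rfl⟩
    · exact ⟨((d.symm, false), x), by simp [toDouble]⟩

theorem doubleAdj_of_resultAdj (hl : 0 < l) (hlm : l = m ∨ m = 0) {i : Fin 3}
    {a b : P.Chamber × Chamber l m} (h : resultAdj l m P i a b) :
    doubleAdj P i (toDouble hl hlm a) (toDouble hl hlm b) := by
  obtain ⟨⟨d, b₁⟩, x⟩ := a
  obtain ⟨D, y⟩ := b
  rcases h with ⟨rfl, hxy, h⟩ | ⟨k, hs, rfl, rfl⟩
  · left
    cases b₁
    · exact ⟨rfl, fun he => hxy (ofChamber_injective hlm hl (mirror_injective he)),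
        fun j hj => congrArg (GC.mirror m) (h j hj)⟩
    · exact ⟨rfl, fun he => hxy (ofChamber_injective hlm hl he), h⟩
  · have hs' := fun j hj => hs.sideForm_eq_zero hl hlm (j := j) hj
    cases b₁ <;> fin_cases k
    · refine Or.inl ⟨rfl, (ofChamber_ne_mirror hlm hl _ _).symm, fun j hj => ?_⟩
      exact mirror_eq_self (hs' j hj)
    · refine Or.inr ⟨1, fun j hj => ?_, ?_, (DoubleChamber.mirror_mirror _).symm⟩
      · change sideForm l m 1 (GC.mirror m (GC.mirror m (x.1 j))) = 0
        rw [GC.mirror_mirror]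
        exact hs' j hj
      · exact congrArg P.rot.symm d.symm_symm.symm
    · refine Or.inr ⟨0, fun j hj => ?_, ?_, (DoubleChamber.mirror_mirror _).symm⟩
      · exact (sideForm_two_mirror _).trans (hs' j hj)
      · exact d.symm_symm.symm
    · refine Or.inl ⟨d.symm_symm.symm, ofChamber_ne_mirror hlm hl _ _, fun j hj => ?_⟩
      exact (mirror_eq_self (hs' j hj)).symm
    · exact Or.inr ⟨2, hs', rfl, rfl⟩
    · exact Or.inr ⟨0, hs', rfl, rfl⟩

/-- The half containing `v₀` meets the remaining side of the equilateral triangle only in the corner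
`v₂`, which is too small to contain an edge. -/
theorem not_doubleForm_extra (hl : 0 < l) (hlm : l = m ∨ m = 0) (x : Chamber l m) (i : Fin 3) :
    ¬ ∀ j, j ≠ i → doubleForm l m 1 (x.1 j) = 0 := by
  intro h
  have hz := fun j hj => eq_zero_of_sideForm_one_mirror (x.sideForm_nonneg hl hlm j) (h j hj)
  have hne : i + 1 ≠ i + 2 := (by decide : ∀ i : Fin 3, i + 1 ≠ i + 2) i
  apply hne
  apply x.2.1.injective
  rw [hz _ ((by decide : ∀ i : Fin 3, i + 1 ≠ i) i), hz _ ((by decide : ∀ i : Fin 3, i + 2 ≠ i) i)]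

/-- Chambers in the two halves of the equilateral triangle that share an edge are mirror images. -/
theorem eq_of_ofChamber_mirror (hl : 0 < l) (hlm : l = m ∨ m = 0) {x y : Chamber l m} {i : Fin 3}
    (h : ∀ j, j ≠ i → x.1 j = GC.mirror m (y.1 j)) : OnSide i 0 x ∧ x = y := by
  have h0 : ∀ j, j ≠ i → sideForm l m 0 (x.1 j) = 0 ∧ x.1 j = y.1 j := by
    intro j hj
    have h1 := x.sideForm_nonneg hl hlm j 0
    have h2 := y.sideForm_nonneg hl hlm j 0
    rw [h j hj, sideForm_zero_mirror] at h1
    have h3 : sideForm l m 0 (y.1 j) = 0 := by omega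
    rw [h j hj, mirror_eq_self h3]
    exact ⟨h3, rfl⟩
  have hside : OnSide i 0 x := fun j hj => (bary_eq_zero_iff hl hlm _ _).2 (h0 j hj).1
  refine ⟨hside, ?_⟩
  by_contra hne
  have hxy : InnerAdj i x y := ⟨hne, fun j hj => (h0 j hj).2⟩
  exact hxy.not_onSide hl hlm hside

theorem resultAdj_of_doubleAdj (hl : 0 < l) (hlm : l = m ∨ m = 0) {i : Fin 3}
    {a b : P.Chamber × Chamber l m} (h : doubleAdj P i (toDouble hl hlm a) (toDouble hl hlm b)) :
    resultAdj l m P i a b := by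
  obtain ⟨⟨d, b₁⟩, x⟩ := a
  obtain ⟨⟨e, b₂⟩, y⟩ := b
  have honSide : ∀ k, (∀ j, j ≠ i → sideForm l m k (x.1 j) = 0) → OnSide i k x :=
    fun k hk j hj => (bary_eq_zero_iff hl hlm _ _).2 (hk j hj)
  rcases h with ⟨h1, h2, h3⟩ | ⟨k, hs, h1, h2⟩
  · cases b₁ <;> cases b₂
    · refine Or.inl ⟨?_, fun he => h2 (by rw [show x = y from he]; rfl), fun j hj => ?_⟩
      · rw [SimpleGraph.Dart.symm_involutive.injective h1]
      · have := congrArg (GC.mirror m) (h3 j hj)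
        simp only [toDouble, DoubleChamber.mirror, GC.mirror_mirror] at this
        exact this
    · obtain ⟨hside, rfl⟩ := eq_of_ofChamber_mirror hl hlm (x := y) (y := x) (i := i)
        fun j hj => (h3 j hj).symm
      exact Or.inr ⟨0, hside, Prod.ext h1 rfl, rfl⟩
    · obtain ⟨hside, rfl⟩ := eq_of_ofChamber_mirror hl hlm (x := x) (y := y) (i := i) h3
      refine Or.inr ⟨0, hside, Prod.ext ?_ rfl, rfl⟩
      rw [show d = e.symm from h1]
      exact e.symm_symm
    · refine Or.inl ⟨?_, fun he => h2 (by rw [show x = y from he]; rfl), h3⟩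
      rw [show d = e from h1]
  · cases b₁ <;> cases b₂
    · simp only [toDouble, DoubleChamber.mirror_mirror] at h2
      exact absurd h2.symm (ofChamber_ne_mirror hlm hl _ _)
    · simp only [toDouble, DoubleChamber.mirror_mirror] at h1 h2 hs
      obtain rfl := ofChamber_injective hlm hl h2
      fin_cases k
      · refine Or.inr ⟨2, honSide 2 fun j hj => ?_, Prod.ext ?_ rfl, rfl⟩
        · exact (sideForm_two_mirror _).symm.trans (hs j hj)
        · rw [h1]; exact d.symm_symm.symm
      · refine Or.inr ⟨1, honSide 1 fun j hj => ?_, Prod.ext ?_ rfl, rfl⟩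
        · have := hs j hj
          simp only [doubleForm, DoubleChamber.mirror, GC.mirror_mirror] at this
          exact this
        · rw [h1]; exact congrArg P.rot.symm d.symm_symm.symm
      · exact absurd hs (not_doubleForm_extra hl hlm y i)
    · simp only [toDouble] at h1 h2 hs
      obtain rfl := ofChamber_injective hlm hl (mirror_injective h2)
      fin_cases k
      · refine Or.inr ⟨2, honSide 2 hs, Prod.ext ?_ rfl, rfl⟩
        exact (SimpleGraph.Dart.symm_involutive.injective h1).symm
      · exact absurd hs (not_doubleForm_extra hl hlm y i)
      · refine Or.inr ⟨1, honSide 1 hs, Prod.ext ?_ rfl, rfl⟩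
        exact (SimpleGraph.Dart.symm_involutive.injective h1).symm
    · exact absurd h2 (ofChamber_ne_mirror hlm hl _ _)

/-- Needed because `Nat.card` is zero for infinite types, which would make the comparison of the two
groups meaningless. -/
theorem finite_chamber (hl : 0 < l) (hlm : l = m ∨ m = 0) : Finite (Chamber l m) := by
  let B : Finset (ℤ × ℤ) := Finset.Icc 0 (6 * (l : ℤ)) ×ˢ Finset.Icc 0 (6 * (l : ℤ))
  refine Finite.of_injective (fun (x : Chamber l m) (i : Fin 3) => (⟨x.1 i, ?_⟩ : B)) ?_
  · have h0 := x.sideForm_nonneg hl hlm i 0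
    have h1 := x.sideForm_nonneg hl hlm i 1
    have h2 := x.sideForm_nonneg hl hlm i 2
    simp only [B, Finset.mem_product, Finset.mem_Icc]
    by_cases hm : m = 0 <;> simp [sideForm, hm] at h0 h1 h2 <;> omega
  · intro x y h
    apply Subtype.ext
    funext i
    exact congrArg Subtype.val (congrFun h i)

section

variable (hlm : l = m ∨ m = 0) (h3 : m = 0 → 3 ∣ l) (T : P.Triality)

/-- The automorphism of the result that is induced by an automorphism of the triangulation by
vertices and faces. -/
def doubleMap (a : P.graph.Dart × DoubleChamber l m) : P.graph.Dart × DoubleChamber l m :=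
  (T.ψ a.1, if T.col a.1 then a.2.turn hlm h3 else (a.2.turn hlm h3).turn hlm h3)

theorem doubleMap_doubleMap (a : P.graph.Dart × DoubleChamber l m) :
    doubleMap hlm h3 T (doubleMap hlm h3 T a) = a := by
  obtain ⟨d, z⟩ := a
  cases h : T.col d <;> simp [doubleMap, T.ψ_ψ, T.col_ψ, h, DoubleChamber.turn_turn_turn]

theorem doubleAdj_doubleMap {i : Fin 3} {a b : P.graph.Dart × DoubleChamber l m}
    (h : doubleAdj P i a b) : doubleAdj P i (doubleMap hlm h3 T a) (doubleMap hlm h3 T b) := by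
  obtain ⟨d, z⟩ := a
  obtain ⟨e, w⟩ := b
  have hinj := DoubleChamber.turn_injective hlm h3
  rcases h with ⟨rfl, h1, h2⟩ | ⟨k, hs, rfl, rfl⟩
  · dsimp only at h1 h2
    left
    cases h : T.col d <;> simp only [doubleMap, h, if_true, Bool.false_eq_true, if_false, true_and]
    · exact ⟨fun he => h1 (hinj (hinj he)),
        fun j hj => congrArg (fun p => GC.turn l m (GC.turn l m p)) (h2 j hj)⟩
    · exact ⟨fun he => h1 (hinj he), fun j hj => congrArg (GC.turn l m) (h2 j hj)⟩
  · right
    dsimp only at hs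
    cases h : T.col d <;>
    simp only [doubleMap, h, if_true, Bool.false_eq_true, if_false, T.col_cross, Bool.not_true,
      Bool.not_false]
    · refine ⟨k + 2, fun j hj => ?_, ?_, ?_⟩
      · have h4 := doubleForm_turn hlm (k + 1) (GC.turn l m (z.1 j))
        rw [doubleForm_turn hlm k, add_assoc] at h4
        exact h4.trans (hs j hj)
      · rw [← T.ψ_cross_succ _ h, add_assoc]
        congr 2
        exact (add_zero k).symm
      · rw [DoubleChamber.mirror_turn, DoubleChamber.mirror_turn,
          DoubleChamber.turn_turn_turn]
    · refine ⟨k + 1, fun j hj => ?_, T.ψ_cross k d h, ?_⟩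
      · exact (doubleForm_turn hlm k (z.1 j)).trans (hs j hj)
      · rw [DoubleChamber.mirror_turn]

end

theorem increasesSymmetry_of_triality [Finite V] (hl : 0 < l) (hlm : l = m ∨ m = 0)
    (h3 : m = 0 → 3 ∣ l) (T : P.Triality) (d₀ : P.graph.Dart) : IncreasesSymmetry l m P := by
  have := finite_chamber hl hlm
  let e : P.Chamber × Chamber l m ≃ P.graph.Dart × DoubleChamber l m :=
    Equiv.ofBijective _ (toDouble_bijective hl hlm)
  have he : ∀ i a b, doubleAdj P i (e a) (e b) ↔ resultAdj l m P i a b := fun i a b =>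
    ⟨resultAdj_of_doubleAdj hl hlm, doubleAdj_of_resultAdj hl hlm⟩
  let θ : Equiv.Perm (P.graph.Dart × DoubleChamber l m) :=
    Function.Involutive.toPerm _ (doubleMap_doubleMap hlm h3 T)
  let σ : Equiv.Perm (P.Chamber × Chamber l m) := (e.trans θ).trans e.symm
  have hσ : σ ∈ chamberAut (resultAdj l m P) := by
    intro i a b
    rw [← he, ← he]
    simp only [σ, Equiv.trans_apply, Equiv.apply_symm_apply]
    refine ⟨fun h => ?_, doubleAdj_doubleMap hlm h3 T⟩
    have := doubleAdj_doubleMap hlm h3 T h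
    change doubleAdj P i (doubleMap hlm h3 T (doubleMap hlm h3 T (e a)))
      (doubleMap hlm h3 T (doubleMap hlm h3 T (e b))) at this
    rwa [doubleMap_doubleMap, doubleMap_doubleMap] at this
  let F : chamberAut P.chamberAdj → chamberAut (resultAdj l m P) := fun τ =>
    ⟨Equiv.prodCongr τ.1 (Equiv.refl _), fun i a b => by
      have := fun k => τ.2 k a.1 b.1
      simp [resultAdj, this]⟩
  have hF : Function.Injective F := by
    intro τ τ' h
    apply Subtype.ext
    apply Equiv.ext
    intro C
    exact congrArg (fun f => (f.1 (C, baseChamber hl hlm)).1) h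
  -- Automorphisms from `P` keep every chamber at a corner `v₂`, and `v₂` is fixed by `mirror`. The
  -- new one turns this corner into `v₀` on darts of colour `true`.
  have hno : ⟨σ, hσ⟩ ∉ Set.range F := by
    rintro ⟨τ, hτ⟩
    have key : ∀ d, (θ (e ((d, true), baseChamber hl hlm))).2.1 2 = (0, 0) := by
      intro d
      have h1 : θ (e ((d, true), baseChamber hl hlm)) =
          e (τ.1 (d, true), baseChamber hl hlm) := by
        have := congrArg (fun f => e (f.1 ((d, true), baseChamber hl hlm))) hτ
        simp only [σ, F, Equiv.trans_apply, Equiv.apply_symm_apply] at this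
        exact this.symm
      rw [h1]
      obtain ⟨d', b⟩ := τ.1 (d, true)
      cases b
      · change GC.mirror m (0, 0) = (0, 0)
        by_cases hm : m = 0 <;> simp [GC.mirror, hm]
      · rfl
    have hturn : ∀ d, T.col d = true → False := by
      intro d hd
      have h1 := key d
      have h2 : (θ (e ((d, true), baseChamber hl hlm))).2.1 2 = GC.turn l m (0, 0) := by
        change (if T.col d then _ else _ : DoubleChamber l m).1 2 = _
        rw [hd]
        rfl
      rw [h2] at h1
      simp [GC.turn] at h1
      omega
    cases hd : T.col d₀
    · exact hturn d₀.symm (by rw [T.col_symm, hd]; rfl)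
    · exact hturn d₀ hd
  exact lt_of_le_of_ne (Nat.card_le_card_of_injective F hF) fun h =>
    hno (((Nat.bijective_iff_injective_and_card F).2 ⟨hF, h⟩).2 _)

end GC

/-! ### Building maps from darts -/

/-- A graph with a rotation system, given by its darts. -/
structure DartSystem (V D : Type) where
  inv : D → D
  inv_inv : ∀ d, inv (inv d) = d
  rot : Equiv.Perm D
  start : D → V
  start_rot : ∀ d, start (rot d) = start d
  sameCycle_of_start : ∀ d d', start d = start d' → rot.SameCycle d d'
  start_inv_ne : ∀ d, start (inv d) ≠ start d
  ext_of_start : ∀ d d', start d = start d' → start (inv d) = start (inv d') → d = d'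

namespace DartSystem

variable {V D F : Type} (S : DartSystem V D)

def graph : SimpleGraph V where
  Adj u v := ∃ d, S.start d = u ∧ S.start (S.inv d) = v
  symm := ⟨by
    rintro u v ⟨d, hu, hv⟩
    exact ⟨S.inv d, hv, by rw [S.inv_inv, hu]⟩⟩
  loopless := ⟨by
    rintro u ⟨d, hu, hv⟩
    exact S.start_inv_ne d (hv.trans hu.symm)⟩

noncomputable def dartEquiv : D ≃ S.graph.Dart :=
  Equiv.ofBijective (fun d => ⟨(S.start d, S.start (S.inv d)), ⟨d, rfl, rfl⟩⟩) (by
    constructor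
    · intro d d' h
      have h' := congrArg SimpleGraph.Dart.toProd h
      exact S.ext_of_start d d' (congrArg Prod.fst h') (congrArg Prod.snd h')
    · rintro ⟨⟨u, v⟩, d, hu, hv⟩
      exact ⟨d, SimpleGraph.Dart.ext _ _ (Prod.ext hu hv)⟩)

theorem dartEquiv_symm (d : D) : (S.dartEquiv d).symm = S.dartEquiv (S.inv d) := by
  apply SimpleGraph.Dart.ext
  apply Prod.ext
  · rfl
  · exact congrArg S.start (S.inv_inv d).symm

theorem zpow_permCongr {X Y : Type} (e : X ≃ Y) (f : Equiv.Perm X) (i : ℤ) (x : X) :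
    (e.permCongr f ^ i) (e x) = e ((f ^ i) x) := by
  have : e.permCongr f ^ i = e.permCongr (f ^ i) := (map_zpow e.permCongrHom f i).symm
  rw [this, Equiv.permCongr_apply, Equiv.symm_apply_apply]

theorem sameCycle_permCongr {X Y : Type} (e : X ≃ Y) (f : Equiv.Perm X) (x y : X) :
    (e.permCongr f).SameCycle (e x) (e y) ↔ f.SameCycle x y := by
  simp only [Equiv.Perm.SameCycle, zpow_permCongr, e.injective.eq_iff]

noncomputable def toRotationMap : RotationMap V where
  graph := S.graph
  rot := S.dartEquiv.permCongr S.rot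
  rot_fst d := by
    obtain ⟨d, rfl⟩ := S.dartEquiv.surjective d
    rw [Equiv.permCongr_apply, Equiv.symm_apply_apply]
    exact S.start_rot d
  rot_cyclic d d' h := by
    obtain ⟨d, rfl⟩ := S.dartEquiv.surjective d
    obtain ⟨d', rfl⟩ := S.dartEquiv.surjective d'
    rw [sameCycle_permCongr]
    exact S.sameCycle_of_start d d' h

/-- The darts of the map. -/
noncomputable def dart : D ≃ S.toRotationMap.graph.Dart := S.dartEquiv

theorem dart_symm (d : D) : (S.dart d).symm = S.dart (S.inv d) := S.dartEquiv_symm d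

theorem rot_dart (d : D) : S.toRotationMap.rot (S.dart d) = S.dart (S.rot d) := by
  change S.dartEquiv.permCongr S.rot (S.dartEquiv d) = S.dartEquiv (S.rot d)
  rw [Equiv.permCongr_apply, Equiv.symm_apply_apply]

def facePerm : Equiv.Perm D :=
  (Function.Involutive.toPerm S.inv S.inv_inv).trans S.rot.symm

theorem facePerm_toRotationMap :
    S.toRotationMap.facePerm = S.dart.permCongr S.facePerm := by
  apply Equiv.ext
  intro d
  obtain ⟨d, rfl⟩ := S.dart.surjective d
  rw [Equiv.permCongr_apply, Equiv.symm_apply_apply]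
  change S.toRotationMap.rot.symm (S.dart d).symm = S.dart (S.rot.symm (S.inv d))
  rw [Equiv.symm_apply_eq, rot_dart, Equiv.apply_symm_apply, dart_symm]

theorem facePerm_dart (d : D) :
    S.toRotationMap.facePerm (S.dart d) = S.dart (S.facePerm d) := by
  rw [facePerm_toRotationMap, Equiv.permCongr_apply, Equiv.symm_apply_apply]

theorem exists_leftFace (f : S.toRotationMap.Face) :
    ∃ d, S.toRotationMap.leftFace (S.dart d) = f := by
  obtain ⟨d, rfl⟩ := S.toRotationMap.leftFace_surjective f
  obtain ⟨d, rfl⟩ := S.dart.surjective d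
  exact ⟨d, rfl⟩

/-- A bijective labelling of the faces. -/
structure FaceLabelling (F : Type) where
  face : D → F
  sameCycle_iff : ∀ d d', S.facePerm.SameCycle d d' ↔ face d = face d'
  surjective : Function.Surjective face

variable {S}

namespace FaceLabelling

variable (L : S.FaceLabelling F)

theorem leftFace_eq_iff (d d' : D) :
    S.toRotationMap.leftFace (S.dart d) = S.toRotationMap.leftFace (S.dart d') ↔
      L.face d = L.face d' := by
  rw [← L.sameCycle_iff, ← sameCycle_permCongr S.dart, ← facePerm_toRotationMap]
  exact Quotient.eq

theorem card_face (L : S.FaceLabelling F) : Nat.card S.toRotationMap.Face = Nat.card F := by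
  choose g hg using S.exists_leftFace
  refine Nat.card_congr (Equiv.ofBijective (fun f => L.face (g f)) ⟨fun f f' h => ?_, fun x => ?_⟩)
  · rw [← hg f, ← hg f', L.leftFace_eq_iff]
    exact h
  · obtain ⟨d, rfl⟩ := L.surjective x
    refine ⟨S.toRotationMap.leftFace (S.dart d), ?_⟩
    rw [← L.leftFace_eq_iff, hg]

theorem hasGenus [Finite V] (L : S.FaceLabelling F) {g : ℕ}
    (h : 2 * (Nat.card V : ℤ) - Nat.card D + 2 * Nat.card F = 4 - 4 * g) :
    S.toRotationMap.HasGenus g := by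
  classical
  have := Fintype.ofFinite V
  have hE : Nat.card D = 2 * Nat.card S.toRotationMap.graph.edgeSet := by
    rw [Nat.card_congr S.dart]
    rw [Nat.card_eq_fintype_card, SimpleGraph.dart_card_eq_twice_card_edges,
      Nat.card_eq_fintype_card, SimpleGraph.card_edgeSet]
  unfold RotationMap.HasGenus
  rw [L.card_face]
  rw [hE] at h
  push_cast at h
  omega

/-- Polyhedrality, stated for the labels of the darts. -/
theorem isPolyhedral (h3 : RotationMap.IsThreeConnected S.graph)
    (hdisk : ∀ d d', L.face d = L.face d' → S.start d = S.start d' → d = d')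
    (hinter : ∀ d₁ d₂ d₃ d₄, L.face d₁ = L.face d₂ → L.face d₃ = L.face d₄ →
      S.start d₁ = S.start d₃ → S.start d₂ = S.start d₄ → S.start d₁ ≠ S.start d₂ →
      L.face d₁ ≠ L.face d₃ → d₄ = S.inv d₁ ∨ d₃ = S.inv d₂) :
    S.toRotationMap.IsPolyhedral where
  threeConnected := h3
  disk d d' := by
    obtain ⟨d, rfl⟩ := S.dart.surjective d
    obtain ⟨d', rfl⟩ := S.dart.surjective d'
    intro h h'
    rw [hdisk d d' ((L.leftFace_eq_iff d d').1 h) h']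
  inter f f' hf := by
    have hverts : ∀ (f : S.toRotationMap.Face) (u : V), u ∈ (S.toRotationMap.boundary f).verts →
        ∃ d, S.toRotationMap.leftFace (S.dart d) = f ∧ S.start d = u := by
      rintro f u ⟨d, hd, hu⟩
      obtain ⟨d, rfl⟩ := S.dart.surjective d
      exact ⟨d, hd, hu⟩
    have hadj : ∀ (f : S.toRotationMap.Face) (d : D),
        S.toRotationMap.leftFace (S.dart d) = f →
        (S.toRotationMap.boundary f).Adj (S.start d) (S.start (S.inv d)) := fun f d hd =>
      ⟨S.dart d, hd, rfl⟩
    rw [SimpleGraph.Subgraph.preconnected_iff]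
    rintro ⟨u, hu, hu'⟩ ⟨v, hv, hv'⟩
    by_cases huv : u = v
    · subst huv
      exact SimpleGraph.Reachable.refl _
    apply SimpleGraph.Adj.reachable
    rw [SimpleGraph.Subgraph.coe_adj]
    obtain ⟨d₁, h1, rfl⟩ := hverts f u hu
    obtain ⟨d₂, h2, rfl⟩ := hverts f v hv
    obtain ⟨d₃, h3, h3'⟩ := hverts f' _ hu'
    obtain ⟨d₄, h4, h4'⟩ := hverts f' _ hv'
    rcases hinter d₁ d₂ d₃ d₄ ((L.leftFace_eq_iff _ _).1 (h1.trans h2.symm))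
      ((L.leftFace_eq_iff _ _).1 (h3.trans h4.symm)) h3'.symm h4'.symm huv
      (fun h => hf (by rw [← h1, ← h3, (L.leftFace_eq_iff _ _).2 h])) with rfl | rfl
    · have a1 := hadj f _ h1
      have a2 := hadj f' _ h4
      rw [S.inv_inv] at a2
      rw [h4'] at a1 a2
      exact ⟨a1, a2.symm⟩
    · have a1 := hadj f _ h2
      have a2 := hadj f' _ h3
      rw [S.inv_inv] at a2
      rw [h3'] at a1 a2
      exact ⟨a1.symm, a2⟩

end FaceLabelling

/-- An involution of the darts that induces a triality of the map. -/
noncomputable def triality (col : D → Bool) (hinv : ∀ d, col (S.inv d) = !col d)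
    (hrot : ∀ d, col (S.rot d) = col d) (ψ : D → D) (hψ : ∀ d, ψ (ψ d) = d)
    (hcol : ∀ d, col (ψ d) = !col d)
    (h0 : ∀ d, col d = true → ψ (S.inv d) = S.facePerm (ψ d))
    (h1 : ∀ d, col d = true → S.facePerm (ψ (S.facePerm d)) = ψ d)
    (h2 : ∀ d, col d = true → ψ (S.facePerm.symm d) = S.inv (ψ d)) :
    S.toRotationMap.Triality where
  col d := col (S.dart.symm d)
  col_symm d := by
    obtain ⟨d, rfl⟩ := S.dart.surjective d
    rw [S.dart_symm, Equiv.symm_apply_apply, Equiv.symm_apply_apply]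
    exact hinv d
  col_rot d := by
    obtain ⟨d, rfl⟩ := S.dart.surjective d
    rw [S.rot_dart, Equiv.symm_apply_apply, Equiv.symm_apply_apply]
    exact hrot d
  ψ d := S.dart (ψ (S.dart.symm d))
  ψ_ψ d := by
    rw [Equiv.symm_apply_apply, hψ, Equiv.apply_symm_apply]
  col_ψ d := by
    rw [Equiv.symm_apply_apply, hcol]
  ψ_cross k d := by
    obtain ⟨d, rfl⟩ := S.dart.surjective d
    have hsymm : ∀ d, S.toRotationMap.facePerm.symm (S.dart d) =
        S.dart (S.facePerm.symm d) := fun d => by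
      rw [Equiv.symm_apply_eq, S.facePerm_dart, Equiv.apply_symm_apply]
    rw [Equiv.symm_apply_apply]
    intro hd
    fin_cases k
    · change S.dart (ψ (S.dart.symm (S.dart d).symm)) =
        S.toRotationMap.facePerm (S.dart (ψ d))
      rw [S.dart_symm, Equiv.symm_apply_apply, h0 d hd, S.facePerm_dart]
    · change S.dart (ψ (S.dart.symm (S.toRotationMap.facePerm (S.dart d)))) =
        S.toRotationMap.facePerm.symm (S.dart (ψ d))
      rw [S.facePerm_dart, Equiv.symm_apply_apply, hsymm]
      congr 1
      rw [Equiv.eq_symm_apply, h1 d hd]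
    · change S.dart (ψ (S.dart.symm (S.toRotationMap.facePerm.symm (S.dart d)))) =
        (S.dart (ψ d)).symm
      rw [hsymm, Equiv.symm_apply_apply, S.dart_symm, h2 d hd]

end DartSystem

/-! ### Cyclic covers of the Heawood map, ramified at one vertex and one face -/

section Ramify

variable {B L : Type} [DecidableEq L] {k : ℕ}

/-- The point over `v` in the sheet `j` of a cyclic cover that is totally ramified over `p`. -/
def ramify (p v : L) (j : ZMod k) : Option ({v : L // v ≠ p} × ZMod k) :=
  if h : v = p then none else some (⟨v, h⟩, j)

theorem ramify_eq_iff (p v w : L) (i j : ZMod k) :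
    ramify p v i = ramify p w j ↔ v = w ∧ (v = p ∨ i = j) := by
  unfold ramify
  by_cases hv : v = p <;> by_cases hw : w = p
  · simp [hv, hw]
  · simp [hv, hw, Ne.symm hw]
  · simp [hv, hw]
  · simp [hv, hw, Prod.ext_iff]

theorem ramify_surjective {p : L} {lab : B → L} (hlab : Function.Surjective lab) (t : B → ℤ) :
    Function.Surjective fun d : B × ZMod k => ramify p (lab d.1) (d.2 + (t d.1 : ZMod k)) := by
  rintro (_ | ⟨⟨v, hv⟩, j⟩)
  · obtain ⟨b, hb⟩ := hlab p
    exact ⟨(b, 0), dif_pos hb⟩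
  · obtain ⟨b, rfl⟩ := hlab v
    refine ⟨(b, j - t b), ?_⟩
    simp [ramify, hv]

/-- The lift of a permutation to a cyclic cover, with voltages `s`. -/
def coverPerm (k : ℕ) (f : Equiv.Perm B) (s : B → ℤ) : Equiv.Perm (B × ZMod k) where
  toFun d := (f d.1, d.2 + s d.1)
  invFun d := (f.symm d.1, d.2 - s (f.symm d.1))
  left_inv d := by simp
  right_inv d := by simp

/-- The lift of a permutation to the universal cover, with voltages `s`. -/
def voltageStep (f : B → B) (s : B → ℤ) (d : B × ℤ) : B × ℤ := (f d.1, d.2 + s d.1)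

theorem coverPerm_pow (f : Equiv.Perm B) (s : B → ℤ) (n : ℕ) (b : B) (j : ZMod k) :
    ((coverPerm k f s) ^ n) (b, j) =
      (((voltageStep f s)^[n] (b, 0)).1, j + ((voltageStep f s)^[n] (b, 0)).2) := by
  induction n with
  | zero => simp
  | succ n ih =>
    rw [pow_succ', Equiv.Perm.mul_apply, ih, Function.iterate_succ_apply']
    simp [coverPerm, voltageStep, add_assoc]

/-- The cycles of the lift of `f` are the points of the ramified cover. -/
theorem sameCycle_coverPerm_iff [NeZero k] (f : Equiv.Perm B) (s : B → ℤ) (lab : B → L)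
    (t : B → ℤ) (p : L) (N : ℕ)
    (hf : ∀ b, lab (f b) = lab b ∧ (lab b ≠ p → s b + t (f b) = t b))
    (hlab : ∀ b b', lab b = lab b' → ∃ n < N, ((voltageStep f s)^[n] (b, 0)).1 = b')
    (hp : ∀ b, lab b = p → (voltageStep f s)^[N] (b, 0) = (b, 1) ∨
      (voltageStep f s)^[N] (b, 0) = (b, -1)) (d d' : B × ZMod k) :
    (coverPerm k f s).SameCycle d d' ↔
      ramify p (lab d.1) (d.2 + (t d.1 : ZMod k)) =
        ramify p (lab d'.1) (d'.2 + (t d'.1 : ZMod k)) := by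
  set g := coverPerm k f s with hg
  have hstep : ∀ d : B × ZMod k, ramify p (lab (g d).1) ((g d).2 + (t (g d).1 : ZMod k)) =
      ramify p (lab d.1) (d.2 + (t d.1 : ZMod k)) := by
    rintro ⟨b, j⟩
    rw [ramify_eq_iff]
    refine ⟨(hf b).1, ?_⟩
    by_cases hb : lab b = p
    · exact Or.inl ((hf b).1.trans hb)
    · right
      have := congrArg (Int.cast : ℤ → ZMod k) ((hf b).2 hb)
      push_cast at this
      change j + (s b : ZMod k) + (t (f b) : ZMod k) = _
      rw [add_assoc, this]
  have hpow : ∀ (n : ℕ) (d : B × ZMod k),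
      ramify p (lab ((g ^ n) d).1) (((g ^ n) d).2 + (t ((g ^ n) d).1 : ZMod k)) =
      ramify p (lab d.1) (d.2 + (t d.1 : ZMod k)) := by
    intro n d
    induction n with
    | zero => rfl
    | succ n ih => rw [pow_succ', Equiv.Perm.mul_apply, hstep, ih]
  constructor
  · rintro ⟨i, rfl⟩
    obtain ⟨n, rfl | rfl⟩ := i.eq_nat_or_neg
    · rw [zpow_natCast, hpow]
    · have h := hpow n ((g ^ n)⁻¹ d)
      rw [← Equiv.Perm.mul_apply, mul_inv_cancel, Equiv.Perm.one_apply] at h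
      rw [h, zpow_neg, zpow_natCast]
  · obtain ⟨b, j⟩ := d
    obtain ⟨b', j'⟩ := d'
    intro h
    obtain ⟨hb, hj⟩ := (ramify_eq_iff _ _ _ _ _).1 h
    obtain ⟨n, -, hn⟩ := hlab b b' hb
    have h1 : g.SameCycle (b, j) ((g ^ n) (b, j)) := ⟨n, by rw [zpow_natCast]⟩
    refine h1.trans ?_
    have h2 := hpow n (b, j)
    rw [coverPerm_pow, hn] at h2 ⊢
    generalize j + _ = i at h2 ⊢
    have h3 := (ramify_eq_iff _ _ _ _ _).1 (h2.trans h)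
    rcases h3.2 with h4 | h4
    -- One turn around the branch point changes the sheet by plus or minus one, a generator of `ZMod
    -- k`, so all sheets over it lie in a single cycle.
    · have key : ∀ i : ZMod k, g.SameCycle (b', i) (b', i + 1) := by
        intro i
        rcases hp b' h4 with h5 | h5
        · refine ⟨N, ?_⟩
          rw [zpow_natCast, coverPerm_pow, h5]
          simp
        · refine Equiv.Perm.SameCycle.symm ⟨N, ?_⟩
          rw [zpow_natCast, coverPerm_pow, h5]
          simp
      have key2 : ∀ n : ℕ, g.SameCycle (b', i) (b', i + n) := by
        intro n
        induction n with
        | zero => simp [Equiv.Perm.SameCycle.refl]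
        | succ n ih =>
          refine ih.trans ?_
          have := key (i + n)
          push_cast
          rwa [add_assoc] at this
      have := key2 (j' - i).val
      rwa [ZMod.natCast_zmod_val, add_sub_cancel] at this
    · have h5 : i = j' := add_right_cancel h4
      rw [h5]

end Ramify

/-! ### The Heawood map, its voltages and its involution -/

namespace HeawoodCover

/-- The darts of the Heawood map on the torus: the edge `(x, a)` joins the black vertex `x` to the
white vertex `x + δ a`. The darts with third entry `true` start at the black vertices. -/
abbrev Base : Type := Fin 7 × Fin 3 × Bool

def δ : Fin 3 → Fin 7 := ![1, 2, 4]

def rev (b : Base) : Base := (b.1, b.2.1, !b.2.2)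

def vertex (b : Base) : Bool × Fin 7 := (b.2.2, if b.2.2 then b.1 else b.1 + δ b.2.1)

/-- Corrects the sheet of a dart so that it becomes constant around each unramified vertex. In these
labels only the edge `(4, 2)`, from black `4` to white `1`, changes the sheet. -/
def vertexSheet (b : Base) : ℤ := if b = (4, 2, false) then 1 else 0

def face (b : Base) : Fin 7 := b.1 - (if b.2.2 then 2 else 4) * δ b.2.1

def faceSheet (b : Base) : ℤ := if b = (0, 0, false) then -1 else 0

def baseRot : Equiv.Perm Base where
  toFun b := (if b.2.2 then b.1 else b.1 + δ b.2.1 - δ (b.2.1 + 2), b.2.1 + 2, b.2.2)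
  invFun b := (if b.2.2 then b.1 else b.1 + δ b.2.1 - δ (b.2.1 + 1), b.2.1 + 1, b.2.2)
  left_inv := by unfold Function.LeftInverse; decide +kernel
  right_inv := by unfold Function.RightInverse Function.LeftInverse; decide +kernel

/-- The sum is `1` around the black vertex `0` and `0` around every other vertex. The induced
`faceVoltage` sums to `-1` around the face `2` and to `0` around the other faces. -/
def rotVoltage (b : Base) : ℤ :=
  if b = (0, 1, true) ∨ b = (4, 2, false) then 1 else if b = (0, 0, false) then -1 else 0

def baseFacePerm : Equiv.Perm Base :=
  (Function.Involutive.toPerm rev (by unfold Function.Involutive; decide +kernel)).trans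
    baseRot.symm

def faceVoltage (b : Base) : ℤ := -rotVoltage (baseFacePerm b)

/-- An orientation-preserving involution that exchanges black `x` with the face `2 - x` and sends
white `w` to `2 - w`; so it exchanges the two branch points. -/
def baseTriality (b : Base) : Base :=
  if b.2.2 then (2 - b.1 + 2 * δ b.2.1, b.2.1 + 2, false)
  else (2 - b.1 + 4 * δ b.2.1, b.2.1 + 1, true)

/-- The correction in the lift `j ↦ -j + trialityVoltage b`. Sheets are reversed because the
monodromies at the exchanged branch points are opposite. -/
def trialityVoltage (b : Base) : ℤ :=
  if b = (0, 0, false) ∨ baseTriality b = (0, 0, false) then 1 else 0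

theorem vertex_rot : ∀ b, vertex (baseRot b) = vertex b ∧
    (vertex b ≠ (true, 0) → rotVoltage b + vertexSheet (baseRot b) = vertexSheet b) := by
  decide +kernel

theorem exists_rot : ∀ b b', vertex b = vertex b' →
    ∃ n < 3, ((voltageStep baseRot rotVoltage)^[n] (b, 0)).1 = b' := by
  decide +kernel

theorem rot_ramified : ∀ b, vertex b = (true, 0) →
    (voltageStep baseRot rotVoltage)^[3] (b, 0) = (b, 1) ∨
      (voltageStep baseRot rotVoltage)^[3] (b, 0) = (b, -1) := by
  decide +kernel

theorem face_facePerm : ∀ b, face (baseFacePerm b) = face b ∧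
    (face b ≠ 2 → faceVoltage b + faceSheet (baseFacePerm b) = faceSheet b) := by
  decide +kernel

theorem exists_facePerm : ∀ b b', face b = face b' →
    ∃ n < 6, ((voltageStep baseFacePerm faceVoltage)^[n] (b, 0)).1 = b' := by
  decide +kernel

theorem facePerm_ramified : ∀ b, face b = 2 →
    (voltageStep baseFacePerm faceVoltage)^[6] (b, 0) = (b, 1) ∨
      (voltageStep baseFacePerm faceVoltage)^[6] (b, 0) = (b, -1) := by
  decide +kernel

theorem ext_vertex_face : ∀ b b', vertex b = vertex b' → face b = face b' → b = b' := by
  decide +kernel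

theorem ext_vertex_rev : ∀ b b', vertex b = vertex b' → vertex (rev b) = vertex (rev b') →
    b = b' := by
  decide +kernel

theorem vertex_rev_ne : ∀ b, vertex (rev b) ≠ vertex b := by
  decide +kernel

/-- The branch points are not incident. Hence a dart of the cover is determined by its start and its
face, and at least one of the two sheet comparisons in `IsCommonEdge` is always available. -/
theorem face_ne_of_vertex : ∀ b, vertex b = (true, 0) → face b ≠ 2 := by
  decide +kernel

theorem rev_rev : ∀ b, rev (rev b) = b := by
  decide +kernel

theorem face_surjective : Function.Surjective face := by
  unfold Function.Surjective
  decide +kernel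

/-- The corners `b₁`, `b₄` of two faces with two common vertices are the ends of a common edge. -/
def IsCommonEdge (b₁ b₂ b₃ b₄ : Base) : Prop :=
  b₄ = rev b₁ ∧
    (vertex b₁ ≠ (true, 0) → face b₃ ≠ 2 →
      vertexSheet b₁ + faceSheet b₃ = vertexSheet b₃ + faceSheet b₄) ∧
    (face b₁ ≠ 2 → vertex b₂ ≠ (true, 0) →
      faceSheet b₁ + vertexSheet b₂ = faceSheet b₂ + vertexSheet b₄)

instance (b₁ b₂ b₃ b₄ : Base) : Decidable (IsCommonEdge b₁ b₂ b₃ b₄) := by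
  unfold IsCommonEdge
  infer_instance

def rotIterate (i : Fin 3) (b : Base) : Base := ((voltageStep baseRot rotVoltage)^[i] (b, 0)).1

def faceIterate (n : Fin 6) (b : Base) : Base :=
  ((voltageStep baseFacePerm faceVoltage)^[n] (b, 0)).1

theorem isCommonEdge_iterate : ∀ b (n : Fin 6) (i i' : Fin 3),
    vertex b ≠ vertex (faceIterate n b) → face b ≠ face (rotIterate i b) →
    face (rotIterate i b) = face (rotIterate i' (faceIterate n b)) →
    IsCommonEdge b (faceIterate n b) (rotIterate i b) (rotIterate i' (faceIterate n b)) ∨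
    IsCommonEdge (faceIterate n b) b (rotIterate i' (faceIterate n b)) (rotIterate i b) := by
  decide +kernel

theorem isCommonEdge_or {b₁ b₂ b₃ b₄ : Base} (h12 : face b₁ = face b₂) (h34 : face b₃ = face b₄)
    (h13 : vertex b₁ = vertex b₃) (h24 : vertex b₂ = vertex b₄) (hv : vertex b₁ ≠ vertex b₂)
    (hf : face b₁ ≠ face b₃) : IsCommonEdge b₁ b₂ b₃ b₄ ∨ IsCommonEdge b₂ b₁ b₄ b₃ := by
  obtain ⟨n, hn, rfl⟩ := exists_facePerm b₁ b₂ h12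
  obtain ⟨i, hi, rfl⟩ := exists_rot b₁ b₃ h13
  obtain ⟨i', hi', rfl⟩ := exists_rot _ b₄ h24
  exact isCommonEdge_iterate b₁ ⟨n, hn⟩ ⟨i, hi⟩ ⟨i', hi'⟩ hv hf h34

theorem triality_triality : ∀ b, baseTriality (baseTriality b) = b ∧
    trialityVoltage (baseTriality b) = trialityVoltage b ∧ (baseTriality b).2.2 = !b.2.2 := by
  decide +kernel

theorem triality_rev : ∀ b : Base, b.2.2 = false →
    baseTriality (rev b) = baseFacePerm (baseTriality b) ∧
      trialityVoltage (rev b) = trialityVoltage b + faceVoltage (baseTriality b) := by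
  decide +kernel

theorem triality_facePerm : ∀ b : Base, b.2.2 = false →
    baseFacePerm (baseTriality (baseFacePerm b)) = baseTriality b ∧
      -faceVoltage b + trialityVoltage (baseFacePerm b) +
        faceVoltage (baseTriality (baseFacePerm b)) = trialityVoltage b := by
  decide +kernel

theorem triality_rot : ∀ b : Base, b.2.2 = false →
    baseTriality (rev (baseRot b)) = rev (baseTriality b) ∧
      -rotVoltage b + trialityVoltage (rev (baseRot b)) = trialityVoltage b := by
  decide +kernel

variable (k : ℕ)

abbrev Vertex : Type := Option ({v : Bool × Fin 7 // v ≠ (true, 0)} × ZMod k)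

abbrev CoverFace : Type := Option ({z : Fin 7 // z ≠ 2} × ZMod k)

abbrev CoverDart : Type := Base × ZMod k

variable {k}

def start (d : CoverDart k) : Vertex k :=
  ramify (true, 0) (vertex d.1) (d.2 + (vertexSheet d.1 : ZMod k))

def coverFace (d : CoverDart k) : CoverFace k :=
  ramify 2 (face d.1) (d.2 + (faceSheet d.1 : ZMod k))

theorem start_eq_iff {d d' : CoverDart k} : start d = start d' ↔ vertex d.1 = vertex d'.1 ∧
    (vertex d.1 = (true, 0) ∨
      d.2 + (vertexSheet d.1 : ZMod k) = d'.2 + (vertexSheet d'.1 : ZMod k)) :=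
  ramify_eq_iff _ _ _ _ _

theorem coverFace_eq_iff {d d' : CoverDart k} : coverFace d = coverFace d' ↔
    face d.1 = face d'.1 ∧
    (face d.1 = 2 ∨ d.2 + (faceSheet d.1 : ZMod k) = d'.2 + (faceSheet d'.1 : ZMod k)) :=
  ramify_eq_iff _ _ _ _ _

theorem ext_start_face {d d' : CoverDart k} (hf : coverFace d = coverFace d')
    (hs : start d = start d') : d = d' := by
  obtain ⟨b, j⟩ := d
  obtain ⟨b', j'⟩ := d'
  rw [start_eq_iff] at hs
  rw [coverFace_eq_iff] at hf
  obtain rfl := ext_vertex_face b b' hs.1 hf.1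
  dsimp only at hs hf
  rcases hs.2 with h | h
  · rcases hf.2 with h' | h'
    · exact (face_ne_of_vertex b h h').elim
    · rw [add_right_cancel h']
  · rw [add_right_cancel h]

variable (k) [NeZero k]

/-- The cover of the Heawood map with `k` sheets, ramified at a vertex and at a face. -/
def system : DartSystem (Vertex k) (CoverDart k) where
  inv d := (rev d.1, d.2)
  inv_inv d := by rw [rev_rev]
  rot := coverPerm k baseRot rotVoltage
  start := start
  start_rot d := (sameCycle_coverPerm_iff baseRot rotVoltage vertex vertexSheet (true, 0) 3
    vertex_rot exists_rot rot_ramified _ _).1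
    (Equiv.Perm.sameCycle_apply_left.2 (Equiv.Perm.SameCycle.refl _ d))
  sameCycle_of_start d d' h := (sameCycle_coverPerm_iff baseRot rotVoltage vertex vertexSheet
    (true, 0) 3 vertex_rot exists_rot rot_ramified d d').2 h
  start_inv_ne d h := vertex_rev_ne d.1 (start_eq_iff.1 h).1
  ext_of_start := by
    rintro ⟨b, j⟩ ⟨b', j'⟩ h h'
    rw [start_eq_iff] at h h'
    obtain ⟨h1, h2⟩ := h
    obtain ⟨h3, h4⟩ := h'
    obtain rfl := ext_vertex_rev b b' h1 h3
    dsimp only at h2 h4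
    rcases h2 with h2 | h2
    · rcases h4 with h4 | h4
      · exact (vertex_rev_ne b (h4.trans h2.symm)).elim
      · rw [add_right_cancel h4]
    · rw [add_right_cancel h2]

theorem facePerm_system : (system k).facePerm = coverPerm k baseFacePerm faceVoltage := by
  ext1 ⟨b, j⟩
  change (baseFacePerm b, j - (rotVoltage (baseFacePerm b) : ZMod k)) =
    (baseFacePerm b, j + (faceVoltage b : ZMod k))
  rw [faceVoltage]
  push_cast
  rw [sub_eq_add_neg]

def faceLabelling : (system k).FaceLabelling (CoverFace k) where
  face := coverFace
  sameCycle_iff d d' := by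
    rw [facePerm_system]
    exact sameCycle_coverPerm_iff baseFacePerm faceVoltage face faceSheet 2 6 face_facePerm
      exists_facePerm facePerm_ramified d d'
  surjective := ramify_surjective face_surjective faceSheet

theorem card_vertex : Nat.card (Vertex k) = 13 * k + 1 := by
  rw [Nat.card_eq_fintype_card, Fintype.card_option, Fintype.card_prod, ZMod.card]
  rfl

theorem hasGenus_system : (system k).toRotationMap.HasGenus k := by
  apply (faceLabelling k).hasGenus
  have hD : Nat.card (CoverDart k) = 42 * k := by
    rw [Nat.card_eq_fintype_card, Fintype.card_prod, ZMod.card]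
    rfl
  have hF : Nat.card (CoverFace k) = 6 * k + 1 := by
    rw [Nat.card_eq_fintype_card, Fintype.card_option, Fintype.card_prod, ZMod.card]
    rfl
  rw [card_vertex, hD, hF]
  push_cast
  ring

/-- Two faces of a cover that have two vertices in common share the edge between them. -/
theorem common_edge {k : ℕ} {d₁ d₂ d₃ d₄ : CoverDart k} (h12 : coverFace d₁ = coverFace d₂)
    (h34 : coverFace d₃ = coverFace d₄) (h13 : start d₁ = start d₃) (h24 : start d₂ = start d₄)
    (hv : start d₁ ≠ start d₂) (hf : coverFace d₁ ≠ coverFace d₃) :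
    d₄ = (rev d₁.1, d₁.2) ∨ d₃ = (rev d₂.1, d₂.2) := by
  obtain ⟨b₁, j₁⟩ := d₁
  obtain ⟨b₂, j₂⟩ := d₂
  obtain ⟨b₃, j₃⟩ := d₃
  obtain ⟨b₄, j₄⟩ := d₄
  simp only [ne_eq, start_eq_iff, coverFace_eq_iff] at *
  obtain ⟨h12, h12'⟩ := h12
  obtain ⟨h34, h34'⟩ := h34
  obtain ⟨h13, h13'⟩ := h13
  obtain ⟨h24, h24'⟩ := h24
  have key : ∀ {b₁ b₂ b₃ b₄ : Base} {j₁ j₂ j₃ j₄ : ZMod k}, IsCommonEdge b₁ b₂ b₃ b₄ →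
      (face b₁ = 2 ∨ j₁ + (faceSheet b₁ : ZMod k) = j₂ + (faceSheet b₂ : ZMod k)) →
      face b₃ = face b₄ →
      (face b₃ = 2 ∨ j₃ + (faceSheet b₃ : ZMod k) = j₄ + (faceSheet b₄ : ZMod k)) →
      (vertex b₁ = (true, 0) ∨ j₁ + (vertexSheet b₁ : ZMod k) = j₃ + (vertexSheet b₃ : ZMod k)) →
      vertex b₂ = vertex b₄ →
      (vertex b₂ = (true, 0) ∨ j₂ + (vertexSheet b₂ : ZMod k) = j₄ + (vertexSheet b₄ : ZMod k)) →
      vertex b₁ ≠ vertex b₂ → face b₁ ≠ face b₃ → ((b₄, j₄) : CoverDart k) = (rev b₁, j₁) := by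
    rintro b₁ b₂ b₃ b₄ j₁ j₂ j₃ j₄ ⟨rfl, e1, e2⟩ h12 h34f h34 h13 h24v h24 hv hf
    congr 1
    -- The sheets of `d₁` and `d₄` are compared through `d₃` if the vertex and the face passed on
    -- that way are unramified, and through `d₂` otherwise.
    by_cases c : vertex b₁ ≠ (true, 0) ∧ face b₃ ≠ 2
    · have e := congrArg (Int.cast : ℤ → ZMod k) (e1 c.1 c.2)
      push_cast at e
      linear_combination e - h13.resolve_left c.1 - h34.resolve_left c.2
    · have c1 : face b₁ ≠ 2 := by
        intro h
        rw [not_and_or, not_not, not_not] at c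
        rcases c with c | c
        · exact face_ne_of_vertex b₁ c h
        · exact hf (h.trans c.symm)
      have c2 : vertex b₂ ≠ (true, 0) := by
        intro h
        rw [not_and_or, not_not, not_not] at c
        rcases c with c | c
        · exact hv (c.trans h.symm)
        · exact face_ne_of_vertex _ (h24v.symm.trans h) (h34f.symm.trans c)
      have e := congrArg (Int.cast : ℤ → ZMod k) (e2 c1 c2)
      push_cast at e
      linear_combination e - h12.resolve_left c1 - h24.resolve_left c2
  -- Distinct vertices or faces of the cover may lie over the same one of the base. For vertices
  -- this forces the first face to be ramified; the second face is then unramified and has only one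
  -- vertex over that base vertex. The case of faces is dual.
  by_cases cv : vertex b₁ = vertex b₂
  · obtain rfl := ext_vertex_face _ _ cv h12
    obtain rfl := ext_vertex_face b₃ b₄ (h13.symm.trans h24) h34
    have c1 : vertex b₁ ≠ (true, 0) := fun h => hv ⟨cv, Or.inl h⟩
    have c2 : face b₁ = 2 := by
      by_contra h
      have := h12'.resolve_left h
      exact hv ⟨cv, Or.inr (by rw [add_right_cancel this])⟩
    have c3 : face b₃ ≠ 2 := fun h => hf ⟨c2.trans h.symm, Or.inl c2⟩
    refine (hv ⟨cv, Or.inr ?_⟩).elim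
    rw [h13'.resolve_left c1, h24'.resolve_left c1, add_right_cancel (h34'.resolve_left c3)]
  · by_cases cf : face b₁ = face b₃
    · obtain rfl := ext_vertex_face _ _ h13 cf
      obtain rfl := ext_vertex_face b₂ b₄ h24 (h12.symm.trans h34)
      have c1 : face b₁ ≠ 2 := fun h => hf ⟨cf, Or.inl h⟩
      have c2 : vertex b₁ = (true, 0) := by
        by_contra h
        have := h13'.resolve_left h
        exact hf ⟨cf, Or.inr (by rw [add_right_cancel this])⟩
      have c3 : vertex b₂ ≠ (true, 0) := fun h => cv (c2.trans h.symm)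
      refine (hf ⟨cf, Or.inr ?_⟩).elim
      rw [h12'.resolve_left c1, h34'.resolve_left c1, add_right_cancel (h24'.resolve_left c3)]
    · rcases isCommonEdge_or h12 h34 h13 h24 cv cf with h | h
      · exact Or.inl (key h h12' h34 h34' h13' h24 h24' cv cf)
      · refine Or.inr (key h (h12'.imp h12.symm.trans Eq.symm) h34.symm
          (h34'.imp h34.symm.trans Eq.symm) h24' h13 h13' (Ne.symm cv) ?_)
        rwa [← h12, ← h34]

theorem isPolyhedral_system (h : RotationMap.IsThreeConnected (system k).graph) :
    (system k).toRotationMap.IsPolyhedral :=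
  (faceLabelling k).isPolyhedral h (fun _ _ => ext_start_face)
    fun _ _ _ _ h12 h34 h13 h24 hv hf => common_edge h12 h34 h13 h24 hv hf

/-- The involution of the darts that exchanges white vertices and faces. -/
noncomputable def trialitySystem : (system k).toRotationMap.Triality :=
  (system k).triality (fun d => !d.1.2.2) (fun _ => rfl) (fun _ => rfl)
    (fun d => (baseTriality d.1, -d.2 + (trialityVoltage d.1 : ZMod k)))
    (by
      rintro ⟨b, j⟩
      obtain ⟨h1, h2, -⟩ := triality_triality b
      simp [h1, h2])
    (fun d => congrArg _ (triality_triality d.1).2.2)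
    (by
      rintro ⟨b, j⟩ hb
      obtain ⟨h1, h2⟩ := triality_rev b (by simpa using hb)
      rw [facePerm_system]
      refine Prod.ext h1 ?_
      change -j + (trialityVoltage (rev b) : ZMod k) =
        -j + (trialityVoltage b : ZMod k) + (faceVoltage (baseTriality b) : ZMod k)
      rw [h2]
      push_cast
      ring)
    (by
      rintro ⟨b, j⟩ hb
      obtain ⟨h1, h2⟩ := triality_facePerm b (by simpa using hb)
      rw [facePerm_system]
      refine Prod.ext h1 ?_
      change -(j + (faceVoltage b : ZMod k)) + (trialityVoltage (baseFacePerm b) : ZMod k) +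
        (faceVoltage (baseTriality (baseFacePerm b)) : ZMod k) = -j + (trialityVoltage b : ZMod k)
      rw [← h2]
      push_cast
      ring)
    (by
      rintro ⟨b, j⟩ hb
      obtain ⟨h1, h2⟩ := triality_rot b (by simpa using hb)
      refine Prod.ext h1 ?_
      change -(j + (rotVoltage b : ZMod k)) + (trialityVoltage (rev (baseRot b)) : ZMod k) =
        -j + (trialityVoltage b : ZMod k)
      rw [← h2]
      push_cast
      ring)

end HeawoodCover

namespace HeawoodCover

/-! ### 3-connectivity of the covers -/

/-- The vertices of the Heawood map. -/
abbrev BaseVertex : Type := Bool × Fin 7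

def neighbour (w : BaseVertex) (a : Fin 3) : BaseVertex :=
  (!w.1, if w.1 then w.2 + δ a else w.2 - δ a)

/-- The change of the sheet along an edge. -/
def shift (w : BaseVertex) (a : Fin 3) : ℤ :=
  if a = 2 then (if w = (true, 4) then 1 else if w = (false, 1) then -1 else 0) else 0

theorem exists_dart : ∀ w a, ∃ b, vertex b = w ∧ vertex (rev b) = neighbour w a ∧
    vertexSheet (rev b) - vertexSheet b = shift w a := by
  decide +kernel

/-- A walk of length at most `n` from `w` to `goals` avoids `bad` and, unless `full`, stays in one
sheet. -/
def hasWalk (full : Bool) (bad goals : List BaseVertex) : ℕ → BaseVertex → Bool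
  | 0, w => decide (w ∈ goals)
  | n + 1, w => decide (w ∈ goals) || decide (∃ a : Fin 3, (full = true ∨ shift w a = 0) ∧
      neighbour w a ∉ bad ∧ hasWalk full bad goals n (neighbour w a) = true)

theorem hasWalk_nil : ∀ w, hasWalk false [] [(true, 0)] 5 w = true := by
  decide +kernel

theorem hasWalk_one : ∀ s, s ≠ (true, 0) → ∀ w ∉ [s],
    hasWalk false [s] [(true, 0)] 5 w = true := by
  decide +kernel

/-- Two deleted vertices can cut off part of a sheet from the branch vertex. That part still
contains an end of the edge that leads to a neighbouring sheet, whence the two extra goals. -/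
theorem hasWalk_two : ∀ s, s ≠ (true, 0) → ∀ t, t ≠ (true, 0) → ∀ w ∉ [s, t],
    hasWalk false [s, t] [(true, 0), (true, 4), (false, 1)] 5 w = true := by
  decide +kernel

/-- With a single sheet there is no other sheet to escape to, but the sheet-changing edge then stays
inside and may be used. -/
theorem hasWalk_full : ∀ s, s ≠ (true, 0) → ∀ t, t ≠ (true, 0) → ∀ w ∉ [s, t],
    hasWalk true [s, t] [(true, 0)] 5 w = true := by
  decide +kernel

theorem hasWalk_branch : ∀ w ∉ [((true, 0) : BaseVertex)],
    hasWalk false [(true, 0)] [(false, 1)] 5 w = true := by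
  decide +kernel

theorem hasWalk_branch_one : ∀ s, s ≠ (true, 0) → ∀ w ∉ [(true, 0), s],
    hasWalk false [(true, 0), s] [(false, 1), (true, 4)] 5 w = true := by
  decide +kernel

theorem hasWalk_branch_full : ∀ s, s ≠ (true, 0) → ∀ w ∉ [(true, 0), s],
    hasWalk true [(true, 0), s] [(true, if s = (true, 1) then 2 else 1)] 5 w = true := by
  decide +kernel

variable {k : ℕ}

def point (w : BaseVertex) (j : ZMod k) : Vertex k := ramify (true, 0) w j

theorem point_eq_iff {v w : BaseVertex} {i j : ZMod k} :
    point v i = point w j ↔ v = w ∧ (v = (true, 0) ∨ i = j) :=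
  ramify_eq_iff _ _ _ _ _

theorem exists_point : ∀ v : Vertex k, ∃ w j, point w j = v
  | none => ⟨(true, 0), 0, rfl⟩
  | some (⟨w, hw⟩, j) => ⟨w, j, dif_neg hw⟩

variable [NeZero k]

theorem adj_point (w : BaseVertex) (a : Fin 3) (j : ZMod k) :
    (system k).graph.Adj (point w j) (point (neighbour w a) (j + (shift w a : ZMod k))) := by
  obtain ⟨b, h1, h2, h3⟩ := exists_dart w a
  refine ⟨(b, j - (vertexSheet b : ZMod k)), ?_, ?_⟩
  · change ramify (true, 0) (vertex b) (j - (vertexSheet b : ZMod k) + (vertexSheet b : ZMod k)) = point w j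
    rw [h1, sub_add_cancel, point]
  · change ramify (true, 0) (vertex (rev b))
      (j - (vertexSheet b : ZMod k) + (vertexSheet (rev b) : ZMod k)) = _
    rw [h2, ← h3, point]
    push_cast
    congr 1
    ring

/-- The vertex `v` is reached from `u` without entering `S`. -/
def ReachOutside (S : Set (Vertex k)) : Vertex k → Vertex k → Prop :=
  Relation.ReflTransGen fun u v => (system k).graph.Adj u v ∧ v ∉ S

theorem ReachOutside.reachable {S : Set (Vertex k)} {u v : Vertex k} (h : ReachOutside S u v)
    (hu : u ∉ S) : ∃ hv : v ∉ S,
      ((system k).graph.induce Sᶜ).Reachable ⟨u, hu⟩ ⟨v, hv⟩ := by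
  induction h with
  | refl => exact ⟨hu, SimpleGraph.Reachable.refl _⟩
  | tail _ h ih =>
    obtain ⟨hv, ih⟩ := ih
    exact ⟨h.2, ih.trans (SimpleGraph.Adj.reachable h.1)⟩

theorem reachOutside_of_hasWalk {S : Set (Vertex k)} {j : ZMod k} {full : Bool}
    {bad goals : List BaseVertex} (hbad : ∀ w, point w j ∈ S → w ∈ bad)
    (hfull : full = true → k = 1) {n : ℕ} {w : BaseVertex}
    (h : hasWalk full bad goals n w = true) :
    ∃ g ∈ goals, ReachOutside S (point w j) (point g j) := by
  induction n generalizing w with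
  | zero => exact ⟨w, of_decide_eq_true h, Relation.ReflTransGen.refl⟩
  | succ n ih =>
    rw [hasWalk, Bool.or_eq_true, decide_eq_true_iff, decide_eq_true_iff] at h
    rcases h with h | ⟨a, h1, h2, h3⟩
    · exact ⟨w, h, Relation.ReflTransGen.refl⟩
    · obtain ⟨g, hg, h4⟩ := ih h3
      refine ⟨g, hg, Relation.ReflTransGen.head ⟨?_, fun h5 => h2 (hbad _ h5)⟩ h4⟩
      have h5 := adj_point w a j
      have h6 : j + (shift w a : ZMod k) = j := by
        rcases h1 with h1 | h1
        · obtain rfl := hfull h1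
          exact Subsingleton.elim _ _
        · rw [h1, Int.cast_zero, add_zero]
      rwa [h6] at h5

theorem reachOutside_goal {S : Set (Vertex k)} {j : ZMod k} {full : Bool} {g : BaseVertex}
    {bad : List BaseVertex} (hbad : ∀ w, point w j ∈ S → w ∈ bad)
    (hfull : full = true → k = 1) {n : ℕ} {w : BaseVertex}
    (h : hasWalk full bad [g] n w = true) : ReachOutside S (point w j) (point g j) := by
  obtain ⟨g', hg', h⟩ := reachOutside_of_hasWalk hbad hfull h
  rwa [List.mem_singleton.1 hg'] at h

theorem adj_next (j : ZMod k) :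
    (system k).graph.Adj (point (true, 4) j) (point (false, 1) (j + 1)) := by
  have h := adj_point (true, 4) 2 j
  rwa [show neighbour (true, 4) 2 = (false, 1) from by decide,
    show shift (true, 4) 2 = 1 from by decide, Int.cast_one] at h

/-- Two vertices different from the branch vertex do not separate a cover. -/
theorem reachOutside_branch {s₁ s₂ : BaseVertex} {j₁ j₂ : ZMod k} (h1 : s₁ ≠ (true, 0))
    (h2 : s₂ ≠ (true, 0)) {w : BaseVertex} {j : ZMod k}
    (hw : point w j ∉ ({point s₁ j₁, point s₂ j₂} : Set (Vertex k))) :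
    ReachOutside {point s₁ j₁, point s₂ j₂} (point w j) (point (true, 0) 0) := by
  set S : Set (Vertex k) := {point s₁ j₁, point s₂ j₂} with hS
  have h0 : ∀ i : ZMod k, point (true, 0) i = (point (true, 0) 0 : Vertex k) := fun i =>
    point_eq_iff.2 ⟨rfl, Or.inl rfl⟩
  have hmem : ∀ w j, point w j ∈ S ↔ (w = s₁ ∧ j = j₁) ∨ (w = s₂ ∧ j = j₂) := by
    intro w j
    rw [hS, Set.mem_insert_iff, Set.mem_singleton_iff, point_eq_iff, point_eq_iff]
    constructor
    · rintro (⟨rfl, h⟩ | ⟨rfl, h⟩)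
      · exact Or.inl ⟨rfl, h.resolve_left h1⟩
      · exact Or.inr ⟨rfl, h.resolve_left h2⟩
    · rintro (⟨rfl, h⟩ | ⟨rfl, h⟩)
      · exact Or.inl ⟨rfl, Or.inr h⟩
      · exact Or.inr ⟨rfl, Or.inr h⟩
  -- The branch vertex belongs to all sheets and serves as the common target; a sheet without
  -- deleted vertices reaches it directly.
  have intact : ∀ w j, j ≠ j₁ → j ≠ j₂ → ReachOutside S (point w j) (point (true, 0) 0) := by
    intro w j c1 c2
    rw [← h0 j]
    refine reachOutside_goal (bad := []) (full := false) (fun w hw => ?_) (by simp) (hasWalk_nil w)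
    rcases (hmem w j).1 hw with h | h
    · exact (c1 h.2).elim
    · exact (c2 h.2).elim
  have one : ∀ s, s ≠ (true, 0) → (∀ w, point w j ∈ S → w = s) → w ≠ s →
      ReachOutside S (point w j) (point (true, 0) 0) := by
    intro s hs hs' hws
    rw [← h0 j]
    exact reachOutside_goal (full := false) (fun w hw => List.mem_singleton.2 (hs' w hw)) (by simp)
      (hasWalk_one s hs w (by simpa using hws))
  rw [hmem] at hw
  by_cases c1 : j = j₁
  · by_cases c2 : j = j₂
    · have hw' : w ∉ [s₁, s₂] := by
        simp only [List.mem_cons, List.not_mem_nil, or_false]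
        tauto
      have hbad : ∀ w, point w j ∈ S → w ∈ [s₁, s₂] := by
        intro w hw
        simp only [List.mem_cons, List.not_mem_nil, or_false]
        exact ((hmem w j).1 hw).imp And.left And.left
      by_cases hk : k = 1
      · rw [← h0 j]
        exact reachOutside_goal hbad (fun _ => hk) (hasWalk_full s₁ h1 s₂ h2 w hw')
      · have h01 : (1 : ZMod k) ≠ 0 := by
          have : Fact (1 < k) := ⟨by have := NeZero.ne k; omega⟩
          exact one_ne_zero
        obtain ⟨g, hg, h⟩ := reachOutside_of_hasWalk (full := false) hbad (by simp)
          (hasWalk_two s₁ h1 s₂ h2 w hw')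
        simp only [List.mem_cons, List.not_mem_nil, or_false] at hg
        rcases hg with rfl | rfl | rfl
        · rwa [h0] at h
        · have hj : j + 1 ≠ j := by simpa using h01
          refine h.trans (Relation.ReflTransGen.head ⟨adj_next j, fun h' => ?_⟩
            (intact (false, 1) (j + 1) (c1 ▸ hj) (c2 ▸ hj)))
          rcases (hmem _ _).1 h' with h' | h'
          · exact hj (h'.2.trans c1.symm)
          · exact hj (h'.2.trans c2.symm)
        · have hj : j - 1 ≠ j := by simpa using h01
          have h3 := (adj_next (j - 1)).symm
          rw [sub_add_cancel] at h3
          refine h.trans (Relation.ReflTransGen.head ⟨h3, fun h' => ?_⟩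
            (intact (true, 4) (j - 1) (c1 ▸ hj) (c2 ▸ hj)))
          rcases (hmem _ _).1 h' with h' | h'
          · exact hj (h'.2.trans c1.symm)
          · exact hj (h'.2.trans c2.symm)
    · refine one s₁ h1 (fun w hw => ?_) (by tauto)
      rcases (hmem w j).1 hw with h | h
      · exact h.1
      · exact (c2 h.2).elim
  · by_cases c2 : j = j₂
    · refine one s₂ h2 (fun w hw => ?_) (by tauto)
      rcases (hmem w j).1 hw with h | h
      · exact (c1 h.2).elim
      · exact h.1
    · exact intact w j c1 c2

/-- The branch vertex and another vertex do not separate a cover. -/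
theorem exists_reachOutside {s : BaseVertex} {j₀ : ZMod k} (hs : s ≠ (true, 0)) :
    ∃ r, ∀ w j, point w j ∉ ({point (true, 0) 0, point s j₀} : Set (Vertex k)) →
      ReachOutside {point (true, 0) 0, point s j₀} (point w j) r := by
  set S : Set (Vertex k) := {point (true, 0) 0, point s j₀} with hS
  have hmem : ∀ w j, point w j ∈ S ↔ w = (true, 0) ∨ (w = s ∧ j = j₀) := by
    intro w j
    rw [hS, Set.mem_insert_iff, Set.mem_singleton_iff, point_eq_iff, point_eq_iff]
    constructor
    · rintro (⟨rfl, -⟩ | ⟨rfl, h⟩)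
      · exact Or.inl rfl
      · exact Or.inr ⟨rfl, h.resolve_left hs⟩
    · rintro (rfl | ⟨rfl, h⟩)
      · exact Or.inl ⟨rfl, Or.inl rfl⟩
      · exact Or.inr ⟨rfl, Or.inr h⟩
  have hbad : ∀ j w, point w j ∈ S → w ∈ [(true, 0), s] := by
    intro j w hw
    simp only [List.mem_cons, List.not_mem_nil, or_false]
    exact ((hmem w j).1 hw).imp id And.left
  have hout : ∀ w, point w j₀ ∉ S → w ∉ [(true, 0), s] := by
    intro w hw
    rw [hmem] at hw
    simp only [List.mem_cons, List.not_mem_nil, or_false]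
    tauto
  by_cases hk : k = 1
  · subst hk
    refine ⟨point (true, if s = (true, 1) then 2 else 1) j₀, fun w j hw => ?_⟩
    obtain rfl : j = j₀ := Subsingleton.elim _ _
    exact reachOutside_goal (hbad j) (fun _ => rfl) (hasWalk_branch_full s hs w (hout w hw))
  have h01 : (1 : ZMod k) ≠ 0 := by
    have : Fact (1 < k) := ⟨by have := NeZero.ne k; omega⟩
    exact one_ne_zero
  have layer : ∀ w j, j ≠ j₀ → w ≠ (true, 0) →
      ReachOutside S (point w j) (point (false, 1) j) := by
    intro w j hj hw
    refine reachOutside_goal (full := false) (fun w hw => ?_) (by simp)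
      (hasWalk_branch w (by simpa using hw))
    rcases (hmem w j).1 hw with h | h
    · exact List.mem_singleton.2 h
    · exact (hj h.2).elim
  have down : ∀ j, j ≠ j₀ → ReachOutside S (point (false, 1) (j + 1)) (point (false, 1) j) := by
    intro j hj
    refine Relation.ReflTransGen.head ⟨(adj_next j).symm, fun h => ?_⟩
      (layer (true, 4) j hj (by decide))
    rcases (hmem _ _).1 h with h | h
    · exact absurd h (by decide)
    · exact hj h.2
  -- Without the branch vertex, the sheets form a cycle joined by the edges from `(true, 4)` to
  -- `(false, 1)` one sheet higher. Leaving out the sheet `j₀` gives a path, which is descended to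
  -- its end `j₀ + 1`.
  have chain : ∀ n : ℕ, n + 1 < k →
      ReachOutside S (point (false, 1) (j₀ + 1 + n)) (point (false, 1) (j₀ + 1)) := by
    intro n hn
    induction n with
    | zero =>
      rw [Nat.cast_zero, add_zero]
      exact Relation.ReflTransGen.refl
    | succ n ih =>
      refine Relation.ReflTransGen.trans ?_ (ih (by omega))
      push_cast
      rw [← add_assoc]
      refine down _ fun h => ?_
      have h' : ((n + 1 : ℕ) : ZMod k) = 0 := by
        push_cast
        linear_combination h
      rw [ZMod.natCast_eq_zero_iff] at h'
      exact absurd (Nat.le_of_dvd n.succ_pos h') (by omega)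
  have other : ∀ w j, j ≠ j₀ → w ≠ (true, 0) →
      ReachOutside S (point w j) (point (false, 1) (j₀ + 1)) := by
    intro w j hj hw
    refine (layer w j hj hw).trans ?_
    have hval : ((j - j₀ - 1).val : ZMod k) = j - j₀ - 1 := ZMod.natCast_zmod_val _
    have h := chain (j - j₀ - 1).val (by
      refine lt_of_le_of_ne (ZMod.val_lt _) fun h => hj ?_
      have h' := congrArg (Nat.cast : ℕ → ZMod k) h
      push_cast at h'
      rw [hval, ZMod.natCast_self] at h'
      linear_combination h')
    rw [hval] at h
    rwa [show j₀ + 1 + (j - j₀ - 1) = j by ring] at h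
  refine ⟨point (false, 1) (j₀ + 1), fun w j hw => ?_⟩
  by_cases hj : j = j₀
  · subst hj
    obtain ⟨g, hg, h⟩ := reachOutside_of_hasWalk (full := false) (hbad j) (by simp)
      (hasWalk_branch_one s hs w (hout w hw))
    simp only [List.mem_cons, List.not_mem_nil, or_false] at hg
    refine h.trans ?_
    rcases hg with rfl | rfl
    · have hj : j - 1 ≠ j := by simpa using h01
      have h3 := (adj_next (j - 1)).symm
      rw [sub_add_cancel] at h3
      refine Relation.ReflTransGen.head ⟨h3, fun h' => ?_⟩ (other _ _ hj (by decide))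
      rcases (hmem _ _).1 h' with h' | h'
      · exact absurd h' (by decide)
      · exact hj h'.2
    · refine Relation.ReflTransGen.single ⟨adj_next j, fun h' => ?_⟩
      rcases (hmem _ _).1 h' with h' | h'
      · exact absurd h' (by decide)
      · exact h01 (by simpa using h'.2)
  · exact other w j hj fun h => hw ((hmem w j).2 (Or.inl h))

theorem exists_root (s₁ s₂ : Vertex k) (h : s₁ ≠ s₂) :
    ∃ r, ∀ v, v ∉ ({s₁, s₂} : Set (Vertex k)) → ReachOutside {s₁, s₂} v r := by
  obtain ⟨w₁, j₁, rfl⟩ := exists_point s₁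
  obtain ⟨w₂, j₂, rfl⟩ := exists_point s₂
  have h0 : ∀ i : ZMod k, point (true, 0) i = (point (true, 0) 0 : Vertex k) := fun i =>
    point_eq_iff.2 ⟨rfl, Or.inl rfl⟩
  by_cases h1 : w₁ = (true, 0)
  · have h2 : w₂ ≠ (true, 0) := by
      rintro rfl
      exact h (by rw [h1, h0 j₁, h0 j₂])
    subst h1
    obtain ⟨r, hr⟩ := exists_reachOutside (j₀ := j₂) h2
    refine ⟨r, fun v hv => ?_⟩
    obtain ⟨w, j, rfl⟩ := exists_point v
    rw [h0 j₁] at hv ⊢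
    exact hr w j hv
  · by_cases h2 : w₂ = (true, 0)
    · subst h2
      obtain ⟨r, hr⟩ := exists_reachOutside (j₀ := j₁) h1
      refine ⟨r, fun v hv => ?_⟩
      obtain ⟨w, j, rfl⟩ := exists_point v
      rw [h0 j₂, Set.pair_comm] at hv ⊢
      exact hr w j hv
    · refine ⟨point (true, 0) 0, fun v hv => ?_⟩
      obtain ⟨w, j, rfl⟩ := exists_point v
      exact reachOutside_branch h1 h2 hv

variable (k) in
theorem isThreeConnected_system : RotationMap.IsThreeConnected (system k).graph := by
  have hcard := card_vertex k
  have hk := NeZero.pos k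
  refine ⟨by omega, fun S hS => ?_⟩
  have hcompl : ∀ T : Set (Vertex k), T.ncard + Tᶜ.ncard = Nat.card (Vertex k) :=
    Set.ncard_add_ncard_compl
  have hne : Sᶜ.Nonempty := by
    apply Set.nonempty_of_ncard_ne_zero
    have := hcompl S
    omega
  rw [SimpleGraph.connected_iff]
  refine ⟨?_, hne.to_subtype⟩
  rintro ⟨u, hu⟩ ⟨v, hv⟩
  have huv : S ⊆ ({u, v} : Set (Vertex k))ᶜ := by
    rintro x hx (rfl | rfl)
    · exact hu hx
    · exact hv hx
  -- Enlarging the deleted set to exactly two vertices, away from `u` and `v`, avoids separate cases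
  -- for smaller sets.
  obtain ⟨T, hST, hT, hT2⟩ := Set.exists_subsuperset_card_eq huv hS (by
    have h1 := hcompl {u, v}
    have h2 := Set.ncard_insert_le u {v}
    rw [Set.ncard_singleton] at h2
    omega)
  obtain ⟨s₁, s₂, hs, rfl⟩ := Set.ncard_eq_two.1 hT2
  obtain ⟨r, hr⟩ := exists_root s₁ s₂ hs
  have hu' : u ∉ ({s₁, s₂} : Set (Vertex k)) := fun h => hT h (Or.inl rfl)
  have hv' : v ∉ ({s₁, s₂} : Set (Vertex k)) := fun h => hT h (Or.inr rfl)
  have mono : ∀ x y, ReachOutside {s₁, s₂} x y → ReachOutside S x y := by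
    intro x y h
    refine Relation.ReflTransGen.mono ?_ x y h
    exact fun a b h => ⟨h.1, fun hb => h.2 (hST hb)⟩
  obtain ⟨_, h1⟩ := (mono _ _ (hr u hu')).reachable hu
  obtain ⟨_, h2⟩ := (mono _ _ (hr v hv')).reachable hv
  exact h1.trans h2.symm

end HeawoodCover
theorem mainTheorem2 (l m g : ℕ) (hl : 0 < l) (hlm : l = m ∨ m = 0)
    (hv₀ : HexTiling.HasColour 2 (GC.corner l m 0)) :
    (m = 0 → ∃ k : ℕ, l = 3 * k) ∧ (GC.CanIncreaseSymmetry l m g ↔ g ≠ 0) := by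
  have h3 : m = 0 → 3 ∣ l := by
    rintro rfl
    -- In doubled coordinates the colour condition reads `3 ∣ 2 l`, and two is invertible modulo
    -- three.
    have h := hv₀.2
    change (3 : ℤ) ∣ 2 * (l : ℤ) - 2 * ((0 : ℕ) : ℤ) at h
    omega
  refine ⟨h3, ?_, fun hg => ?_⟩
  · rintro ⟨V, _, P, hP, hPg, h⟩ rfl
    exact GC.not_increasesSymmetry hl hlm h3 hP.threeConnected hPg h
  · have : NeZero g := ⟨hg⟩
    exact ⟨_, inferInstance, _,
      HeawoodCover.isPolyhedral_system g (HeawoodCover.isThreeConnected_system g),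
      HeawoodCover.hasGenus_system g,
      GC.increasesSymmetry_of_triality hl hlm h3 (HeawoodCover.trialitySystem g)
        ((HeawoodCover.system g).dart ((0, 0, true), 0))⟩
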